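/- **Theorem (MLE-centric total variation bound).** Let $n,d\ge 1$ be integers, let $\pi:\mathbb R^d\to[0,\infty)$ be a Lebesgue probability density (the prior) and let $L_n:\mathbb R^d\to\mathbb R$ (the generalized log-likelihood) be such that $e^{L_n}\pi$ is Lebesgue measurable. Let $\tilde\theta_n$ be distributed according to the generalized posterior, with density $\Pi_n(\theta)=e^{L_n(\theta)}\pi(\theta)/z_n$, $z_n=\int e^{L_n}\pi$. Write $\hat J_n(\theta)=-L_n''(\theta)/n$, let $\|\cdot\|$ be the Euclidean norm, $\|T\|^*=\sup_{\|u\|,\|v\|,\|w\|\le1}|T[u,v,w]|$ for a trilinear form $T$, and $\|\cdot\|_{op}$ the spectral norm. Assume that there are real numbers $\delta,M_2,\hat M_1,\kappa,M_1,\widetilde M_1>0$ such that: - $L_n$ has a unique global maximizer $\hat\theta_n$ (the MLE), $L_n$ is three times differentiable in $\{\theta:\|\theta-\hat\theta_n\|\le\delta\}$, and $\sup_{\|\theta-\hat\theta_n\|\le\delta}\|L_n'''(\theta)\|^*/n\le M_2$; - $\pi$ is positive on $\{\theta:\|\theta-\hat\theta_n\|\le\delta\}$ and $\sup_{\|\theta-\hat\theta_n\|\le\delta}|1/\pi(\theta)|\le\hat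 M_1$; - $\sqrt{\operatorname{Tr}[\hat J_n(\hat\theta_n)^{-1}]/n}<\delta$; - the minimal eigenvalue $\lambda_{\min}$ of $\hat J_n(\hat\theta_n)$ satisfies $\lambda_{\min}>\delta M_2$; - $\sup_{\|\theta-\hat\theta_n\|>\delta}\,(L_n(\theta)-L_n(\hat\theta_n))/n\le-\kappa$; - $\pi$ is differentiable at every $\theta$ with $\|\theta-\hat\theta_n\|\le\delta$, $\sup_{\|\theta-\hat\theta_n\|\le\delta}\|\pi'(\theta)/\pi(\theta)\|\le M_1$ and $\sup_{\|\theta-\hat\theta_n\|\le\delta}|\pi(\theta)|\le\widetilde M_1$. Put $\hat J^p_n=\hat J_n(\hat\theta_n)+\tfrac{\delta M_2}{3}I_{d\times d}$, $\hat\lambda^p_{\min}=\|(\hat J^p_n)^{-1}\|_{op}^{-1}$ and $$\hat D=\exp\Big[-\tfrac12\big(\delta\sqrt n-\sqrt{\operatorname{Tr}[\hat J_n(\hat\theta_n)^{-1}]}\big)^2\lambda_{\min}\Big],\qquad \hat D^p=\exp\Big[-\tfrac12\big(\delta\sqrt n-\sqrt{\operatorname{Tr}[(\hat J^p_n)^{-1}]}\big)^2\hat\lambda^p_{\min}\Big].$$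 Then, with $TV(\mu,\nu)=\sup_A|\mu(A)-\nu(A)|$ over Borel sets $A$, $$TV\Big(\mathcal L\big(\sqrt n(\tilde\theta_n-\hat\theta_n)\big),\,\mathcal N\big(0,\hat J_n(\hat\theta_n)^{-1}\big)\Big)\le \frac{\sqrt3\,\operatorname{Tr}[\hat J_n(\hat\theta_n)^{-1}]\sqrt{\widetilde M_1\hat M_1}\,M_2}{4\sqrt{n(\lambda_{\min}-\delta M_2)(1-\hat D)}}+\frac{M_1\sqrt{\widetilde M_1\hat M_1}}{2\sqrt{n(\lambda_{\min}-\delta M_2)}}+2\hat D+\frac{2\,n^{d/2}e^{-n\kappa}\hat M_1\,|\det\hat J^p_n|^{1/2}}{(2\pi)^{d/2}\,(1-\hat D^p)}$$ (in the last denominator $\pi$ is the number $3.14\ldots$). -/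

import Mathlib

open MeasureTheory ProbabilityTheory

namespace Laplace

/-- Total variation distance of two probability measures, `sup_A |μ(A) - ν(A)|` over
measurable sets `A`. -/
noncomputable def tvDist {Ω : Type*} [MeasurableSpace Ω] (μ ν : Measure Ω) : ℝ :=
  ⨆ A : {A : Set Ω // MeasurableSet A}, |μ.real A.1 - ν.real A.1|

/-- The generalized posterior: the measure on `ℝᵈ` with Lebesgue density `exp (L θ) * prior θ / z`,
where `z` is the normalizing constant. -/
noncomputable def posterior {d : ℕ} (L prior : EuclideanSpace ℝ (Fin d) → ℝ) :
    Measure (EuclideanSpace ℝ (Fin d)) :=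
  volume.withDensity fun θ =>
    ENNReal.ofReal (Real.exp (L θ) * prior θ / ∫ t, Real.exp (L t) * prior t)

/-- The law of `√n (θ̃ - θhat)` where `θ̃` is distributed according to the generalized posterior. -/
noncomputable def rescaledPosterior {d : ℕ} (n : ℕ) (L prior : EuclideanSpace ℝ (Fin d) → ℝ)
    (θhat : EuclideanSpace ℝ (Fin d)) : Measure (EuclideanSpace ℝ (Fin d)) :=
  (posterior L prior).map fun θ => Real.sqrt n • (θ - θhat)

/-- `θhat` is the unique global maximizer of `L`. -/
def IsMLE {d : ℕ} (L : EuclideanSpace ℝ (Fin d) → ℝ) (θhat : EuclideanSpace ℝ (Fin d)) : Prop :=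
  (∀ θ, L θ ≤ L θhat) ∧ ∀ θ', (∀ θ, L θ ≤ L θ') → θ' = θhat

/-- `f` has (Fréchet) derivatives up to order three at every point of `s`; the third derivative is
not required to be continuous. -/
def ThriceDifferentiable {d : ℕ} (f : EuclideanSpace ℝ (Fin d) → ℝ)
    (s : Set (EuclideanSpace ℝ (Fin d))) : Prop :=
  ∀ θ ∈ s, ∀ k < 3, DifferentiableAt ℝ (iteratedFDeriv ℝ k f) θ

/-- The Hessian matrix of second partial derivatives. -/
noncomputable def hessian {d : ℕ} (f : EuclideanSpace ℝ (Fin d) → ℝ)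
    (θ : EuclideanSpace ℝ (Fin d)) : Matrix (Fin d) (Fin d) ℝ :=
  Matrix.of fun i j =>
    iteratedFDeriv ℝ 2 f θ ![EuclideanSpace.single i 1, EuclideanSpace.single j 1]

/-- `Ĵₙ(θ) = - L''(θ) / n`. -/
noncomputable def Jhat {d : ℕ} (n : ℕ) (L : EuclideanSpace ℝ (Fin d) → ℝ)
    (θ : EuclideanSpace ℝ (Fin d)) : Matrix (Fin d) (Fin d) ℝ :=
  -((n : ℝ)⁻¹ • hessian L θ)

/-- `Ĵᵖₙ = Ĵₙ + (δ M₂ / 3) I`. -/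
noncomputable def JhatP {d : ℕ} (n : ℕ) (L : EuclideanSpace ℝ (Fin d) → ℝ)
    (θ : EuclideanSpace ℝ (Fin d)) (δ M₂ : ℝ) : Matrix (Fin d) (Fin d) ℝ :=
  Jhat n L θ + (δ * M₂ / 3) • (1 : Matrix (Fin d) (Fin d) ℝ)

/-- The minimal eigenvalue of a real symmetric matrix. -/
noncomputable def lamMin {d : ℕ} (A : Matrix (Fin d) (Fin d) ℝ) : ℝ :=
  sInf (spectrum ℝ A)

/-- The spectral (Euclidean operator) norm of a matrix. -/
noncomputable def opNorm {d : ℕ} (A : Matrix (Fin d) (Fin d) ℝ) : ℝ :=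
  ‖Matrix.toEuclideanCLM (n := Fin d) (𝕜 := ℝ) A‖

/-- `D̂(n, δ)`. -/
noncomputable def Dhat {d : ℕ} (n : ℕ) (L : EuclideanSpace ℝ (Fin d) → ℝ)
    (θhat : EuclideanSpace ℝ (Fin d)) (δ : ℝ) : ℝ :=
  Real.exp (-(1 / 2) * (δ * Real.sqrt n - Real.sqrt ((Jhat n L θhat)⁻¹.trace)) ^ 2
    * lamMin (Jhat n L θhat))

/-- `D̂ᵖ(n, δ)`, in which the minimal eigenvalue of `Ĵᵖₙ` is written as `‖(Ĵᵖₙ)⁻¹‖⁻¹`. -/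
noncomputable def DhatP {d : ℕ} (n : ℕ) (L : EuclideanSpace ℝ (Fin d) → ℝ)
    (θhat : EuclideanSpace ℝ (Fin d)) (δ M₂ : ℝ) : ℝ :=
  Real.exp (-(1 / 2) * (δ * Real.sqrt n - Real.sqrt ((JhatP n L θhat δ M₂)⁻¹.trace)) ^ 2
    * (opNorm (JhatP n L θhat δ M₂)⁻¹)⁻¹)

end Laplace

/-! In the coordinate h = θ - θhat the Gaussian limit has precision n Ĵ; the dilation by √n only
replaces each test set by its preimage. Let B be the ball of radius δ about the mode. Passing
through the two laws conditioned on B, the distance is at most the mass that each law puts outside B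
plus the distance between the conditioned laws.

Inside B. The Hessian of L at the mode is at most -n λ_min, and the bound on the third derivative
moves it by at most n δ M₂, so L is strongly concave on B with constant ρ = n (λ_min - δ M₂). Hence
the weight exp L satisfies a Poincaré inequality on B with constant 1/ρ. Apply it to the square root
g of the ratio of the Gaussian density to the posterior density. The normalized variance of g under
the posterior is one minus the squared Bhattacharyya coefficient, which dominates the squared total
variation, and the energy of g is a quarter of a relative Fisher information. The difference of
scores is a Taylor remainder, at most n M₂ ‖h‖² / 2, plus the logarithmic gradient of the prior; the
Gaussian fourth moment then produces √3 times the trace. The prior need not be log-concave, so it is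
treated as a bounded perturbation, which costs the product of its upper and inverse lower bounds.
This is `sq_setIntegral_exp_div_sub_le` and `abs_setIntegral_posterior_ball_sub_le`.

The Poincaré inequality comes from Prékopa-Leindler: the one-dimensional case
`prekopa_leindler_real` is tensorized, it yields Maurey's property τ for strongly log-concave
weights, and expanding property τ to second order in a small parameter gives the spectral gap
(`PropertyTau.integral_sq_le`, `exists_setIntegral_sub_sq_mul_exp_le`).

Outside B. The Gaussian mass is bounded by a Chernoff argument (`setIntegral_exp_neg_diagForm_le`).
For the posterior mass (`setIntegral_posterior_compl_le`), the gap κ bounds the numerator, and the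
normalizing constant is bounded below by a Gaussian integral with precision n Ĵᵖ, whose shift δ M₂ /
3 absorbs the cubic Taylor remainder on B. -/

section

open Filter Topology
open scoped ENNReal Pointwise

/-! ### Brunn-Minkowski and Prékopa-Leindler on the real line. -/

/-- One-dimensional Brunn-Minkowski inequality for compact sets. -/
theorem Real.volume_add_le_volume_add_of_isCompact {K₁ K₂ : Set ℝ} (h₁ : IsCompact K₁)
    (h₂ : IsCompact K₂) (hn₁ : K₁.Nonempty) (hn₂ : K₂.Nonempty) :
    volume K₁ + volume K₂ ≤ volume (K₁ + K₂) := by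
  -- With a = max K₁ and b = min K₂, the translates K₁ + b and a + K₂ lie in K₁ + K₂ on either side
  -- of a + b, so they overlap in at most one point.
  obtain ⟨a, ha, hamax⟩ := h₁.exists_isGreatest hn₁
  obtain ⟨b, hb, hbmin⟩ := h₂.exists_isLeast hn₂
  have e₁ : volume ((fun x => x + b) '' K₁) = volume K₁ := by
    rw [Set.image_add_right, measure_preimage_add_right]
  have e₂ : volume ((fun x => a + x) '' K₂) = volume K₂ := by
    rw [Set.image_add_left, measure_preimage_add]
  have hm : MeasurableSet ((fun x => a + x) '' K₂) :=
    (h₂.image (by fun_prop)).measurableSet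
  have hinter : volume ((fun x => x + b) '' K₁ ∩ (fun x => a + x) '' K₂) = 0 := by
    refine measure_mono_null (t := {a + b}) ?_ (by simp)
    rintro _ ⟨⟨x, hx, rfl⟩, y, hy, hxy⟩
    have h1 := hamax hx
    have h2 := hbmin hy
    simp only [Set.mem_singleton_iff] at *
    linarith
  rw [← e₁, ← e₂, ← measure_union_add_inter _ hm, hinter, add_zero]
  refine measure_mono (Set.union_subset ?_ ?_)
  · rintro _ ⟨x, hx, rfl⟩
    exact Set.add_mem_add hx hb
  · rintro _ ⟨x, hx, rfl⟩
    exact Set.add_mem_add ha hx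

/-- Inner regularity reduces the claim to compact subsets of A and B. A fixed point of each set is
inserted into these, since Brunn-Minkowski fails for an empty summand. No measurability of C is
needed. -/
theorem Real.volume_add_volume_le_of_midpoint_mem {A B C : Set ℝ} (hA : MeasurableSet A)
    (hB : MeasurableSet B) (hnA : A.Nonempty) (hnB : B.Nonempty)
    (h : ∀ x ∈ A, ∀ y ∈ B, (1 / 2 : ℝ) • (x + y) ∈ C) :
    volume A + volume B ≤ 2 * volume C := by
  obtain ⟨a, ha⟩ := hnA
  obtain ⟨b, hb⟩ := hnB
  have key : ∀ K₁ ⊆ A, IsCompact K₁ → ∀ K₂ ⊆ B, IsCompact K₂ →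
      volume K₁ + volume K₂ ≤ 2 * volume C := by
    intro K₁ s₁ c₁ K₂ s₂ c₂
    have hk := Real.volume_add_le_volume_add_of_isCompact (c₁.insert a) (c₂.insert b)
      (Set.insert_nonempty _ _) (Set.insert_nonempty _ _)
    have hsub : (1 / 2 : ℝ) • (insert a K₁ + insert b K₂) ⊆ C := by
      rintro _ ⟨_, ⟨x, hx, y, hy, rfl⟩, rfl⟩
      exact h x (Set.insert_subset ha s₁ hx) y (Set.insert_subset hb s₂ hy)
    have hvol := measure_mono (μ := volume) hsub
    rw [Measure.addHaar_smul] at hvol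
    calc volume K₁ + volume K₂ ≤ volume (insert a K₁) + volume (insert b K₂) :=
          add_le_add (measure_mono (Set.subset_insert _ _)) (measure_mono (Set.subset_insert _ _))
      _ ≤ volume (insert a K₁ + insert b K₂) := hk
      _ = 2 * (ENNReal.ofReal |(1 / 2 : ℝ) ^ Module.finrank ℝ ℝ| *
            volume (insert a K₁ + insert b K₂)) := by
          rw [← mul_assoc]
          have : (2 : ℝ≥0∞) * ENNReal.ofReal |(1 / 2 : ℝ) ^ Module.finrank ℝ ℝ| = 1 := by
            rw [← ENNReal.ofReal_ofNat, ← ENNReal.ofReal_mul (by norm_num)]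
            norm_num
          rw [this, one_mul]
      _ ≤ 2 * volume C := by gcongr
  rw [hA.measure_eq_iSup_isCompact, hB.measure_eq_iSup_isCompact]
  simp_rw [iSup_and']
  exact ENNReal.biSup_add_biSup_le' ⟨∅, by simp⟩ ⟨∅, by simp⟩
    fun K₁ k₁ K₂ k₂ => key K₁ k₁.1 k₁.2 K₂ k₂.1 k₂.2

theorem ENNReal.mul_le_sq_of_add_le_two_mul {a b c : ℝ≥0∞} (h : a + b ≤ 2 * c) :
    a * b ≤ c ^ 2 := by
  rcases eq_or_ne c ∞ with rfl | hc
  · simp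
  have hab : a + b ≠ ∞ := ne_top_of_le_ne_top (ENNReal.mul_ne_top (by simp) hc) h
  have ha : a ≠ ∞ := ne_top_of_le_ne_top hab le_self_add
  have hb : b ≠ ∞ := ne_top_of_le_ne_top hab le_add_self
  lift a to NNReal using ha
  lift b to NNReal using hb
  lift c to NNReal using hc
  norm_cast at *
  have h' : (a : ℝ) + b ≤ 2 * c := by exact_mod_cast h
  have : (a : ℝ) * b ≤ (c : ℝ) ^ 2 := by
    nlinarith [sq_nonneg ((a : ℝ) - b), a.2, b.2, c.2, add_nonneg a.2 b.2]
  exact_mod_cast this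

/-- Layer cake formula for functions with values in `[0, 1]`. -/
theorem lintegral_eq_lintegral_meas_lt_of_le_one {u : ℝ → ℝ≥0∞} (hu : Measurable u)
    (hu1 : ∀ x, u x ≤ 1) :
    ∫⁻ x, u x = ∫⁻ t in Set.Ioo (0 : ℝ) 1, volume {x | ENNReal.ofReal t < u x} := by
  have hfin : ∀ x, u x ≠ ∞ := fun x => ne_top_of_le_ne_top ENNReal.one_ne_top (hu1 x)
  have e : ∫⁻ x, u x = ∫⁻ x, ENNReal.ofReal (u x).toReal :=
    lintegral_congr fun x => (ENNReal.ofReal_toReal (hfin x)).symm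
  rw [e, lintegral_eq_lintegral_meas_lt volume (ae_of_all _ fun x => ENNReal.toReal_nonneg)
    hu.ennreal_toReal.aemeasurable]
  have hs : ∀ t ∈ Set.Ioi (0 : ℝ), {x | t < (u x).toReal} = {x | ENNReal.ofReal t < u x} := by
    intro t ht
    ext x
    simp only [Set.mem_ofPred_eq]
    rw [ENNReal.ofReal_lt_iff_lt_toReal (le_of_lt ht) (hfin x)]
  rw [setLIntegral_congr_fun measurableSet_Ioi (fun t ht => by rw [hs t ht]),
    ← Set.Ioo_union_Ici_eq_Ioi (zero_lt_one' ℝ), lintegral_union measurableSet_Ici]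
  · rw [setLIntegral_eq_zero measurableSet_Ici, add_zero]
    intro t ht
    have : {x | ENNReal.ofReal t < u x} = ∅ := by
      ext x
      simp only [Set.mem_ofPred_eq, Set.mem_empty_iff_false, iff_false, not_lt]
      exact (hu1 x).trans (by simpa using ht)
    simp [this]
  · exact Set.disjoint_left.2 fun x hx hx' => absurd hx.2 (not_lt.2 hx')

/-- Integrate the set inequality over the levels t in (0, 1). Normalizing both suprema to 1 makes
the superlevel sets of u and v nonempty at exactly these levels; w may exceed 1, so it is truncated
there. -/
theorem lintegral_add_lintegral_le_of_forall_lt {u v w : ℝ → ℝ≥0∞} (hu : Measurable u)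
    (hv : Measurable v) (hw : Measurable w) (hu1 : ⨆ x, u x = 1) (hv1 : ⨆ x, v x = 1)
    (h : ∀ x y t, t < u x → t < v y → t < w ((1 / 2 : ℝ) • (x + y))) :
    (∫⁻ x, u x) + ∫⁻ x, v x ≤ 2 * ∫⁻ x, w x := by
  have hw' : ∫⁻ x, min (w x) 1 ≤ ∫⁻ x, w x := lintegral_mono fun x => min_le_left _ _
  refine le_trans ?_ (mul_le_mul_right hw' 2)
  have hu1' : ∀ x, u x ≤ 1 := fun x => hu1 ▸ le_iSup u x
  have hv1' : ∀ x, v x ≤ 1 := fun x => hv1 ▸ le_iSup v x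
  rw [lintegral_eq_lintegral_meas_lt_of_le_one hu hu1',
    lintegral_eq_lintegral_meas_lt_of_le_one hv hv1',
    lintegral_eq_lintegral_meas_lt_of_le_one (hw.min measurable_const) fun x => min_le_right _ _,
    ← lintegral_const_mul' _ _ ENNReal.ofNat_ne_top, ← lintegral_add_left']
  · refine setLIntegral_mono' measurableSet_Ioo fun t ht => ?_
    have ht1 : ENNReal.ofReal t < 1 := by simpa using ht.2
    refine Real.volume_add_volume_le_of_midpoint_mem (measurableSet_lt measurable_const hu)
      (measurableSet_lt measurable_const hv) ?_ ?_ fun x hx y hy => ?_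
    · exact lt_iSup_iff.1 (hu1 ▸ ht1)
    · exact lt_iSup_iff.1 (hv1 ▸ ht1)
    · exact lt_min (h x y _ hx hy) ht1
  · refine (Antitone.measurable fun s t hst => measure_mono fun x hx => ?_).aemeasurable
    exact lt_of_le_of_lt (ENNReal.ofReal_le_ofReal hst) hx

/-- The midpoint Prékopa-Leindler inequality on the real line, for bounded functions. -/
theorem prekopa_leindler_real_of_bounded {u v w : ℝ → ℝ≥0∞} (hu : Measurable u)
    (hv : Measurable v) (hw : Measurable w) (hub : ⨆ x, u x ≠ ∞) (hvb : ⨆ x, v x ≠ ∞)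
    (h : ∀ x y, u x * v y ≤ w ((1 / 2 : ℝ) • (x + y)) ^ 2) :
    (∫⁻ x, u x) * ∫⁻ x, v x ≤ (∫⁻ x, w x) ^ 2 := by
  set a := ⨆ x, u x with ha
  set b := ⨆ x, v x with hb
  rcases eq_or_ne a 0 with ha0 | ha0
  · have : ∀ x, u x = 0 := fun x => le_antisymm (ha0 ▸ le_iSup u x) zero_le
    simp [this]
  rcases eq_or_ne b 0 with hb0 | hb0
  · have : ∀ x, v x = 0 := fun x => le_antisymm (hb0 ▸ le_iSup v x) zero_le
    simp [this]
  -- Dividing u, v by their suprema and w by the geometric mean of the suprema preserves the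
  -- hypothesis. The additive inequality for the normalized functions then becomes multiplicative by
  -- the arithmetic-geometric mean inequality.
  set c : ℝ≥0∞ := (a * b) ^ (1 / 2 : ℝ) with hc
  have hcc : c ^ 2 = a * b := by
    rw [hc, ← ENNReal.rpow_natCast, ← ENNReal.rpow_mul]
    norm_num
  have hab : a * b ≠ ∞ := ENNReal.mul_ne_top hub hvb
  have hc0 : c ≠ 0 := fun h0 => mul_ne_zero ha0 hb0 (by rw [← hcc, h0]; simp)
  have hct : c ≠ ∞ := fun h0 => hab (by rw [← hcc, h0]; simp)
  have key := lintegral_add_lintegral_le_of_forall_lt (u := fun x => a⁻¹ * u x)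
    (v := fun x => b⁻¹ * v x) (w := fun x => c⁻¹ * w x) (hu.const_mul _) (hv.const_mul _)
    (hw.const_mul _) (by rw [← ENNReal.mul_iSup, ENNReal.inv_mul_cancel ha0 hub])
    (by rw [← ENNReal.mul_iSup, ENNReal.inv_mul_cancel hb0 hvb]) (fun x y t h₁ h₂ => ?_)
  · rw [lintegral_const_mul _ hu, lintegral_const_mul _ hv, lintegral_const_mul _ hw] at key
    have k2 := ENNReal.mul_le_sq_of_add_le_two_mul key
    calc (∫⁻ x, u x) * ∫⁻ x, v x
        = (a * b) * ((a⁻¹ * ∫⁻ x, u x) * (b⁻¹ * ∫⁻ x, v x)) := by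
          rw [show (a * b) * ((a⁻¹ * ∫⁻ x, u x) * (b⁻¹ * ∫⁻ x, v x))
            = (a * a⁻¹) * (b * b⁻¹) * ((∫⁻ x, u x) * ∫⁻ x, v x) by ring,
            ENNReal.mul_inv_cancel ha0 hub, ENNReal.mul_inv_cancel hb0 hvb]
          simp
      _ ≤ (a * b) * (c⁻¹ * ∫⁻ x, w x) ^ 2 := by gcongr
      _ = (∫⁻ x, w x) ^ 2 := by
          rw [← hcc, ← mul_pow, ← mul_assoc, ENNReal.mul_inv_cancel hc0 hct, one_mul]
  · have h3 : t ^ 2 < (c⁻¹ * w ((1 / 2 : ℝ) • (x + y))) ^ 2 := by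
      calc t ^ 2 = t * t := sq t
        _ < (a⁻¹ * u x) * (b⁻¹ * v y) := ENNReal.mul_lt_mul h₁ h₂
        _ = (a * b)⁻¹ * (u x * v y) := by
          rw [ENNReal.mul_inv (Or.inl ha0) (Or.inl hub)]; ring
        _ ≤ (a * b)⁻¹ * w ((1 / 2 : ℝ) • (x + y)) ^ 2 := by gcongr; exact h x y
        _ = _ := by rw [← hcc, mul_pow, ENNReal.inv_pow]
    exact lt_of_not_ge fun hle => h3.not_ge (pow_le_pow_left' hle 2)

/-- The midpoint Prékopa-Leindler inequality on the real line. -/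
theorem prekopa_leindler_real {u v w : ℝ → ℝ≥0∞} (hu : Measurable u)
    (hv : Measurable v) (hw : Measurable w)
    (h : ∀ x y, u x * v y ≤ w ((1 / 2 : ℝ) • (x + y)) ^ 2) :
    (∫⁻ x, u x) * ∫⁻ x, v x ≤ (∫⁻ x, w x) ^ 2 := by
  -- Truncating u and v at height N keeps the hypothesis with the same w; monotone convergence
  -- removes the truncation.
  have lim : ∀ f : ℝ → ℝ≥0∞, Measurable f →
      ∫⁻ x, f x = ⨆ N : ℕ, ∫⁻ x, min (f x) N := by
    intro f hf
    rw [← lintegral_iSup (fun N => hf.min measurable_const)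
      (fun i j hij x => min_le_min le_rfl (by exact_mod_cast hij))]
    refine lintegral_congr fun x => ?_
    rw [← inf_iSup_eq]
    simp [ENNReal.iSup_natCast]
  rw [lim u hu, lim v hv]
  rw [ENNReal.iSup_mul]
  refine iSup_le fun i => ?_
  rw [ENNReal.mul_iSup]
  refine iSup_le fun j => ?_
  refine prekopa_leindler_real_of_bounded (hu.min measurable_const) (hv.min measurable_const) hw
    ?_ ?_ fun x y => le_trans (mul_le_mul' (min_le_left _ _) (min_le_left _ _)) (h x y)
  · exact ne_top_of_le_ne_top (ENNReal.natCast_ne_top i) (iSup_le fun x => min_le_right _ _)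
  · exact ne_top_of_le_ne_top (ENNReal.natCast_ne_top j) (iSup_le fun x => min_le_right _ _)

/-! ### Tensorization of the Prékopa-Leindler inequality. -/

/-- The midpoint Prékopa-Leindler inequality holds for the measure `μ`. -/
def MidpointPrekopaLeindler {E : Type*} [AddCommGroup E] [Module ℝ E] [MeasurableSpace E]
    (μ : Measure E) : Prop :=
  ∀ u v w : E → ℝ≥0∞, Measurable u → Measurable v → Measurable w →
    (∀ x y, u x * v y ≤ w ((1 / 2 : ℝ) • (x + y)) ^ 2) →
    (∫⁻ x, u x ∂μ) * ∫⁻ x, v x ∂μ ≤ (∫⁻ x, w x ∂μ) ^ 2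

namespace MidpointPrekopaLeindler

variable {E F : Type*} [AddCommGroup E] [Module ℝ E] [MeasurableSpace E]
  [AddCommGroup F] [Module ℝ F] [MeasurableSpace F] {μ : Measure E} {ν : Measure F}

/-- For fixed first coordinates x and y, the inequality for ν on the fibres over x, y and their
midpoint is precisely the hypothesis needed to apply the inequality for μ to the fibre integrals. -/
theorem prod [SFinite μ] [SFinite ν] (hμ : MidpointPrekopaLeindler μ)
    (hν : MidpointPrekopaLeindler ν) : MidpointPrekopaLeindler (μ.prod ν) := by
  intro u v w hu hv hw h
  rw [lintegral_prod _ hu.aemeasurable, lintegral_prod _ hv.aemeasurable,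
    lintegral_prod _ hw.aemeasurable]
  refine hμ _ _ _ hu.lintegral_prod_right' hv.lintegral_prod_right' hw.lintegral_prod_right'
    fun x y => ?_
  exact hν _ _ _ (hu.comp measurable_prodMk_left) (hv.comp measurable_prodMk_left)
    (hw.comp measurable_prodMk_left) fun s t => h (x, s) (y, t)

theorem of_measurePreserving (f : E ≃ₗ[ℝ] F) (hf : MeasurePreserving f μ ν)
    (hμ : MidpointPrekopaLeindler μ) : MidpointPrekopaLeindler ν := by
  intro u v w hu hv hw h
  rw [← hf.lintegral_comp hu, ← hf.lintegral_comp hv, ← hf.lintegral_comp hw]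
  refine hμ _ _ _ (hu.comp hf.measurable) (hv.comp hf.measurable) (hw.comp hf.measurable)
    fun x y => ?_
  simpa using h (f x) (f y)

theorem pi_volume (d : ℕ) : MidpointPrekopaLeindler (volume : Measure (Fin d → ℝ)) := by
  induction d with
  | zero =>
    intro u v w hu hv hw h
    rw [volume_pi, Measure.pi_of_empty _ 0]
    rw [lintegral_dirac' _ hu, lintegral_dirac' _ hv, lintegral_dirac' _ hw]
    simpa using h 0 0
  | succ d ih =>
    have hr : MidpointPrekopaLeindler (volume : Measure ℝ) :=
      fun u v w hu hv hw h => prekopa_leindler_real hu hv hw h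
    have hp := (volume_preserving_piFinSuccAbove (fun _ : Fin (d + 1) => ℝ) 0).symm
    exact of_measurePreserving (Fin.consLinearEquiv ℝ (fun _ : Fin (d + 1) => ℝ)) (by
      have he : ⇑(Fin.consLinearEquiv ℝ fun _ : Fin (d + 1) => ℝ)
          = ⇑(MeasurableEquiv.piFinSuccAbove (fun _ : Fin (d + 1) => ℝ) 0).symm := by
        ext x i
        simp [MeasurableEquiv.piFinSuccAbove, Fin.consLinearEquiv, Fin.insertNthEquiv,
          Fin.consEquiv]
      rw [he]
      exact hp) (hr.prod ih)

theorem euclideanSpace_volume (d : ℕ) :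
    MidpointPrekopaLeindler (volume : Measure (EuclideanSpace ℝ (Fin d))) :=
  of_measurePreserving (WithLp.linearEquiv 2 ℝ (Fin d → ℝ)).symm
    (PiLp.volume_preserving_toLp (Fin d)) (pi_volume d)

end MidpointPrekopaLeindler

/-! ### Property τ and its linearization to a Poincaré inequality. -/

/-- A second-order lower bound for the exponential. -/
theorem Real.one_add_add_sq_div_two_sub_le_exp {x : ℝ} (hx : |x| ≤ 1) :
    1 + x + x ^ 2 / 2 - |x| ^ 3 ≤ Real.exp x := by
  have h := Real.exp_bound hx (n := 3) (by norm_num)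
  simp only [Finset.sum_range_succ, Finset.sum_range_zero] at h
  have h3 : 0 ≤ |x| ^ 3 := by positivity
  have h4 := (abs_le.1 h).1
  norm_num [Nat.factorial] at h4
  nlinarith

/-- Maurey's property `τ` with quadratic cost: the inf-convolution inequality, tested on bounded
measurable functions. -/
def PropertyTau {E : Type*} [NormedAddCommGroup E] [MeasurableSpace E] (μ : Measure E)
    (B : Set E) (ρ : ℝ) : Prop :=
  ∀ φ ψ : E → ℝ, Measurable φ → Measurable ψ → (∃ C, ∀ x ∈ B, |φ x| ≤ C) →
    (∃ C, ∀ x ∈ B, |ψ x| ≤ C) →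
    (∀ x ∈ B, ∀ y ∈ B, φ x ≤ ψ y + ρ / 4 * ‖x - y‖ ^ 2) →
    (∫ x, Real.exp (φ x) ∂μ) * ∫ x, Real.exp (-ψ x) ∂μ ≤ μ.real Set.univ ^ 2

section InfConvolution

variable {E : Type*} [NormedAddCommGroup E]

/-- The inf-convolution of `f` with a quadratic cost over the set `B`. -/
noncomputable def infConv (B : Set E) (ρ : ℝ) (f : E → ℝ) (x : E) : ℝ :=
  ⨅ y : B, (f y + ρ / 4 * ‖x - y‖ ^ 2)

variable {B : Set E} {ρ : ℝ} {f : E → ℝ} {C : ℝ}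

theorem bddBelow_infConv (hρ : 0 ≤ ρ) (hf : ∀ y ∈ B, -C ≤ f y) (x : E) :
    BddBelow (Set.range fun y : B => f y + ρ / 4 * ‖x - y‖ ^ 2) := by
  refine ⟨-C, ?_⟩
  rintro _ ⟨y, rfl⟩
  have := hf y y.2
  have : 0 ≤ ρ / 4 * ‖x - y‖ ^ 2 := by positivity
  simp only
  linarith

theorem infConv_le (hρ : 0 ≤ ρ) (hf : ∀ y ∈ B, -C ≤ f y) (x : E) {y : E} (hy : y ∈ B) :
    infConv B ρ f x ≤ f y + ρ / 4 * ‖x - y‖ ^ 2 :=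
  ciInf_le (bddBelow_infConv hρ hf x) ⟨y, hy⟩

theorem le_infConv (hB : B.Nonempty) {x : E} {c : ℝ}
    (h : ∀ y ∈ B, c ≤ f y + ρ / 4 * ‖x - y‖ ^ 2) : c ≤ infConv B ρ f x := by
  have := hB.to_subtype
  exact le_ciInf fun y => h y y.2

/-- The infimum runs over an uncountable set, but each member is continuous in x, so it is upper
semicontinuous. -/
theorem measurable_infConv [MeasurableSpace E] [BorelSpace E] (hρ : 0 ≤ ρ)
    (hf : ∀ y ∈ B, -C ≤ f y) : Measurable (infConv B ρ f) := by
  refine UpperSemicontinuous.measurable ?_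
  refine upperSemicontinuous_ciInf (fun x => bddBelow_infConv hρ hf x) fun y => ?_
  exact Continuous.upperSemicontinuous (by fun_prop)

end InfConvolution

/-- Second-order lower bound for `∫ exp (ε g - ε² R)` when `g` has mean zero. -/
theorem le_integral_exp_of_integral_eq_zero {E : Type*} [MeasurableSpace E] {μ : Measure E}
    [IsFiniteMeasure μ] {B : Set E} {G C ε : ℝ} (hμB : ∀ᵐ x ∂μ, x ∈ B) (hG0 : 0 ≤ G)
    {g R : E → ℝ} (hg : Measurable g) (hR : Measurable R) (hgG : ∀ x ∈ B, |g x| ≤ G)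
    (hR0 : ∀ x ∈ B, 0 ≤ R x) (hRC : ∀ x ∈ B, R x ≤ C) (hC0 : 0 ≤ C) (hg0 : ∫ x, g x ∂μ = 0)
    (hε : 0 < ε) (hεH : ε * (G + C + 1) ≤ 1) :
    μ.real Set.univ + ε ^ 2 * ((∫ x, g x ^ 2 ∂μ) / 2 - ∫ x, R x ∂μ
        - ε * (μ.real Set.univ * ((G + C + 1) ^ 2 + (G + C + 1) ^ 3)))
      ≤ ∫ x, Real.exp (ε * g x - ε ^ 2 * R x) ∂μ := by
  -- A single constant for all errors: ε H bounds the exponent on B, and H ≥ 1 turns ε H ≤ 1 into ε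
  -- ≤ 1.
  set H := G + C + 1 with hH
  have hHpos : 0 < H := by positivity
  have hε1 : ε ≤ 1 := by nlinarith
  have hbdd : ∀ f : E → ℝ, Measurable f → ∀ c, (∀ x ∈ B, |f x| ≤ c) → Integrable f μ := by
    intro f hf c hfc
    refine Integrable.of_bound hf.aestronglyMeasurable c ?_
    filter_upwards [hμB] with x hx using hfc x hx
  have hgi : Integrable g μ := hbdd g hg G hgG
  have hg2i : Integrable (fun x => g x ^ 2) μ := hbdd _ (hg.pow_const 2) (G ^ 2) fun x hx => by
    rw [abs_pow]; exact pow_le_pow_left₀ (abs_nonneg _) (hgG x hx) 2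
  have hRi : Integrable R μ := hbdd _ hR C fun x hx => by
    rw [abs_of_nonneg (hR0 x hx)]; exact hRC x hx
  have hφb : ∀ x ∈ B, |ε * g x - ε ^ 2 * R x| ≤ ε * H := by
    intro x hx
    have h1 := abs_le.1 (hgG x hx)
    have h2 := hR0 x hx
    have h3 := hRC x hx
    have h4 : ε ^ 2 * R x ≤ ε * C := by nlinarith [mul_nonneg hε.le h2]
    have h5 : 0 ≤ ε ^ 2 * R x := by positivity
    rw [abs_le, hH]
    constructor <;> nlinarith
  have hexp : Integrable (fun x => Real.exp (ε * g x - ε ^ 2 * R x)) μ := by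
    refine hbdd _ ((hg.const_mul _).sub (hR.const_mul _)).exp (Real.exp (ε * H)) fun x hx => ?_
    rw [abs_of_pos (Real.exp_pos _)]
    exact Real.exp_le_exp.2 ((le_abs_self _).trans (hφb x hx))
  have i1 : Integrable (fun x => ε * g x) μ := hgi.const_mul _
  have i2 : Integrable (fun x => 1 + ε * g x) μ := (integrable_const _).add i1
  have i3 : Integrable (fun x => g x ^ 2 / 2) μ := hg2i.div_const _
  have i4 : Integrable (fun x => ε ^ 2 * (g x ^ 2 / 2 - R x)) μ := (i3.sub hRi).const_mul _
  have i5 : Integrable (fun x => 1 + ε * g x + ε ^ 2 * (g x ^ 2 / 2 - R x)) μ := i2.add i4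
  have e : ∫ x, (1 + ε * g x + ε ^ 2 * (g x ^ 2 / 2 - R x) - ε ^ 3 * (H ^ 2 + H ^ 3)) ∂μ
      = μ.real Set.univ + ε ^ 2 * ((∫ x, g x ^ 2 ∂μ) / 2 - ∫ x, R x ∂μ
        - ε * (μ.real Set.univ * (H ^ 2 + H ^ 3))) := by
    rw [integral_sub i5 (integrable_const _), integral_add i2 i4,
      integral_add (integrable_const _) i1, integral_const_mul, integral_const_mul,
      integral_sub i3 hRi, integral_div, hg0]
    simp only [integral_const, smul_eq_mul]
    ring
  rw [← e]
  refine integral_mono_ae (i5.sub (integrable_const _)) hexp ?_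
  filter_upwards [hμB] with x hx
  refine le_trans ?_ (Real.one_add_add_sq_div_two_sub_le_exp ((hφb x hx).trans hεH))
  have h1 : |ε * g x - ε ^ 2 * R x| ^ 3 ≤ (ε * H) ^ 3 :=
    pow_le_pow_left₀ (abs_nonneg _) (hφb x hx) 3
  -- Two errors of order ε³ occur: the cross term of the square, which gives H ^ 2, and the cubic
  -- remainder of the exponential, which gives H ^ 3. The ε⁴ term is nonnegative and is dropped.
  have h2 : g x * R x ≤ H ^ 2 := by
    have h3 := hR0 x hx
    calc g x * R x ≤ G * C :=
          mul_le_mul (abs_le.1 (hgG x hx)).2 (hRC x hx) h3 hG0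
      _ ≤ H ^ 2 := by nlinarith
  have h3 : ε ^ 3 * (g x * R x) ≤ ε ^ 3 * H ^ 2 := by gcongr
  have h4 : 0 ≤ ε ^ 4 * R x ^ 2 := by positivity
  rw [mul_pow] at h1
  have h6 : (ε * g x - ε ^ 2 * R x) ^ 2 / 2
    = ε ^ 2 * (g x ^ 2 / 2) - ε ^ 3 * (g x * R x) + ε ^ 4 * R x ^ 2 / 2 := by ring
  rw [h6]
  linarith

/-- Linearization of property `τ`: a Poincaré inequality, with the squared norm of the gradient
replaced by any asymptotic upper bound `D` of the rescaled inf-convolution defect. -/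
theorem PropertyTau.integral_sq_le {E : Type*} [NormedAddCommGroup E] [MeasurableSpace E]
    [BorelSpace E] {μ : Measure E} [IsFiniteMeasure μ] {B : Set E} {ρ G C : ℝ}
    (hτ : PropertyTau μ B ρ) (hμB : ∀ᵐ x ∂μ, x ∈ B) (hB : B.Nonempty)
    (hρ : 0 ≤ ρ) {g D : E → ℝ} (hg : Measurable g) (hD : Measurable D)
    (hgG : ∀ x ∈ B, |g x| ≤ G) (hD0 : ∀ x ∈ B, 0 ≤ D x) (hDC : ∀ x ∈ B, D x ≤ C)
    (hg0 : ∫ x, g x ∂μ = 0)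
    (hC : ∀ x ∈ B, ∀ y ∈ B, ∀ ε > 0, ε * (g x - g y) - ρ / 4 * ‖x - y‖ ^ 2 ≤ ε ^ 2 * C)
    (hlim : ∀ x ∈ B, ∀ η > 0, ∀ᶠ ε in 𝓝[>] (0 : ℝ), ∀ y ∈ B,
      ε * (g x - g y) - ρ / 4 * ‖x - y‖ ^ 2 ≤ ε ^ 2 * (D x + η)) :
    ∫ x, g x ^ 2 ∂μ ≤ ∫ x, D x ∂μ := by
  rcases eq_or_ne μ 0 with rfl | hμ0
  · simp
  set W := μ.real Set.univ with hW
  have hWpos : 0 < W := by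
    rw [hW, measureReal_def]
    exact ENNReal.toReal_pos (by simpa using hμ0) (measure_ne_top _ _)
  obtain ⟨x₀, hx₀⟩ := hB
  have hG0 : 0 ≤ G := (abs_nonneg _).trans (hgG x₀ hx₀)
  have hC0 : 0 ≤ C := (hD0 x₀ hx₀).trans (hDC x₀ hx₀)
  set H := G + C + 1 with hH
  have hHpos : 0 < H := by positivity
  -- the truncated defect
  let R : ℝ → E → ℝ := fun ε x =>
    max ((ε * g x - infConv B ρ (fun y => ε * g y) x) / ε ^ 2) (D x)
  have hlow : ∀ ε > 0, ∀ y ∈ B, -(ε * G) ≤ ε * g y := by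
    intro ε hε y hy
    nlinarith [(abs_le.1 (hgG y hy)).1]
  have hRm : ∀ ε > 0, Measurable (R ε) := fun ε hε =>
    (((hg.const_mul ε).sub (measurable_infConv hρ (hlow ε hε))).div_const _).max hD
  have hRle : ∀ ε > 0, ∀ x ∈ B, ∀ c, D x ≤ c →
      (∀ y ∈ B, ε * (g x - g y) - ρ / 4 * ‖x - y‖ ^ 2 ≤ ε ^ 2 * c) → R ε x ≤ c := by
    intro ε hε x hx c hc hy
    refine max_le ?_ hc
    rw [div_le_iff₀ (by positivity)]
    have : ε * g x - ε ^ 2 * c ≤ infConv B ρ (fun y => ε * g y) x :=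
      le_infConv ⟨x₀, hx₀⟩ fun y hyB => by linarith [hy y hyB]
    linarith
  have hRC : ∀ ε > 0, ∀ x ∈ B, R ε x ≤ C := fun ε hε x hx =>
    hRle ε hε x hx C (hDC x hx) fun y hy => hC x hx y hy ε hε
  have hR0 : ∀ ε, ∀ x ∈ B, 0 ≤ R ε x := fun ε x hx => le_max_of_le_right (hD0 x hx)
  -- The pair tested in property τ: since ε² R dominates the gap between ε g and its
  -- inf-convolution, ε g - ε² R lies below the inf-convolution of ε g.
  have hφψ : ∀ ε > 0, ∀ x ∈ B, ∀ y ∈ B,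
      ε * g x - ε ^ 2 * R ε x ≤ ε * g y + ρ / 4 * ‖x - y‖ ^ 2 := by
    intro ε hε x hx y hy
    refine le_trans ?_ (infConv_le (f := fun y => ε * g y) hρ (hlow ε hε) x hy)
    have h1 : (ε * g x - infConv B ρ (fun y => ε * g y) x) / ε ^ 2 ≤ R ε x := le_max_left _ _
    rw [div_le_iff₀ (by positivity)] at h1
    linarith
  -- dominated convergence
  have hRlim : Tendsto (fun ε => ∫ x, R ε x ∂μ) (𝓝[>] 0) (𝓝 (∫ x, D x ∂μ)) := by
    refine tendsto_integral_filter_of_dominated_convergence (fun _ => C) ?_ ?_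
      (integrable_const _) ?_
    · filter_upwards [self_mem_nhdsWithin] with ε hε
      exact (hRm ε hε).aestronglyMeasurable
    · filter_upwards [self_mem_nhdsWithin] with ε hε
      filter_upwards [hμB] with x hx
      rw [Real.norm_of_nonneg (hR0 ε x hx)]
      exact hRC ε hε x hx
    · filter_upwards [hμB] with x hx
      -- The maximum with D makes the lower half of the convergence automatic, so only the upper
      -- bound `hlim` is needed.
      rw [tendsto_order]
      refine ⟨fun a ha => Eventually.of_forall fun ε => ha.trans_le (le_max_right _ _),
        fun a ha => ?_⟩
      filter_upwards [hlim x hx ((a - D x) / 2) (by linarith), self_mem_nhdsWithin] with ε h1 hε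
      exact (hRle ε hε x hx _ (by linarith) h1).trans_lt (by linarith)
  set S := ∫ x, g x ^ 2 ∂μ with hS
  set c := W * (H ^ 2 + H ^ 3) with hc
  -- the expanded inequality
  have hmain : ∀ᶠ ε in 𝓝[>] (0 : ℝ),
      W * ((S / 2 - ∫ x, R ε x ∂μ - ε * c) + (S / 2 - ε * c))
        + ε ^ 2 * ((S / 2 - ∫ x, R ε x ∂μ - ε * c) * (S / 2 - ε * c)) ≤ 0 := by
    have hid : Tendsto (fun ε : ℝ => ε) (𝓝[>] 0) (𝓝 0) := tendsto_nhdsWithin_of_tendsto_nhds tendsto_id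
    have hα : Tendsto (fun ε => W + ε ^ 2 * (S / 2 - ∫ x, R ε x ∂μ - ε * c)) (𝓝[>] 0)
        (𝓝 (W + 0 ^ 2 * (S / 2 - ∫ x, D x ∂μ - 0 * c))) :=
      tendsto_const_nhds.add ((hid.pow 2).mul
        ((tendsto_const_nhds.sub hRlim).sub (hid.mul tendsto_const_nhds)))
    have hβ : Tendsto (fun ε => W + ε ^ 2 * (S / 2 - ε * c)) (𝓝[>] 0)
        (𝓝 (W + 0 ^ 2 * (S / 2 - 0 * c))) :=
      tendsto_const_nhds.add ((hid.pow 2).mul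
        (tendsto_const_nhds.sub (hid.mul tendsto_const_nhds)))
    have hα' := hα.eventually (lt_mem_nhds (a := 0) (by simpa using hWpos))
    have hβ' := hβ.eventually (lt_mem_nhds (a := 0) (by simpa using hWpos))
    have hsmall : ∀ᶠ ε in 𝓝[>] (0 : ℝ), ε < H⁻¹ := by
      exact hid.eventually (gt_mem_nhds (inv_pos.2 hHpos))
    filter_upwards [hα', hβ', hsmall, self_mem_nhdsWithin] with ε ha hb hs hε
    have hε : 0 < ε := hε
    have hεH : ε * H ≤ 1 := by
      have := mul_le_mul_of_nonneg_right hs.le hHpos.le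
      rwa [inv_mul_cancel₀ hHpos.ne'] at this
    have hε1 : ε ≤ 1 := by nlinarith
    have hφm : Measurable fun x => ε * g x - ε ^ 2 * R ε x :=
      (hg.const_mul _).sub ((hRm ε hε).const_mul _)
    have hψm : Measurable fun x => ε * g x := hg.const_mul _
    have hφb : ∀ x ∈ B, |ε * g x - ε ^ 2 * R ε x| ≤ ε * H := by
      intro x hx
      have h1 := abs_le.1 (hgG x hx)
      have h2 := hR0 ε x hx
      have h3 := hRC ε hε x hx
      have h4 : ε ^ 2 * R ε x ≤ ε * C := by nlinarith [mul_nonneg hε.le h2]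
      have h5 : 0 ≤ ε ^ 2 * R ε x := by positivity
      rw [abs_le, hH]
      constructor <;> nlinarith
    have hψb : ∀ x ∈ B, |ε * g x| ≤ ε * H := by
      intro x hx
      rw [abs_mul, abs_of_pos hε]
      have := hgG x hx
      nlinarith
    have hτ' := hτ _ _ hφm hψm ⟨_, hφb⟩ ⟨_, hψb⟩ (hφψ ε hε)
    have hA : W + ε ^ 2 * (S / 2 - ∫ x, R ε x ∂μ - ε * c)
        ≤ ∫ x, Real.exp (ε * g x - ε ^ 2 * R ε x) ∂μ := le_integral_exp_of_integral_eq_zero hμB hG0 hg (hRm ε hε) hgG (hR0 ε)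
      (hRC ε hε) hC0 hg0 hε hεH
    -- The second factor is the same expansion for -g with no defect, R = 0.
    have hBb := le_integral_exp_of_integral_eq_zero hμB hG0 hg.neg (measurable_const (a := (0 : ℝ)))
      (fun x hx => by rw [Pi.neg_apply, abs_neg]; exact hgG x hx) (fun _ _ => le_rfl)
      (fun _ _ => hC0) hC0 (by simp [integral_neg, hg0]) hε hεH
    simp only [Pi.neg_apply, neg_sq, integral_zero, mul_zero, sub_zero, mul_neg] at hBb
    replace hBb : W + ε ^ 2 * (S / 2 - ε * c) ≤ ∫ x, Real.exp (-(ε * g x)) ∂μ := hBb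
    -- In the product of the two expansions the zeroth-order term W ^ 2 cancels against the right
    -- side of property τ, so division by ε² exposes the second-order coefficient.
    have hprod : _ ≤ W ^ 2 := (mul_le_mul hA hBb hb.le (ha.le.trans hA)).trans hτ'
    have hε2 : 0 < ε ^ 2 := by positivity
    refine le_of_mul_le_mul_left ?_ hε2
    generalize S / 2 - ∫ x, R ε x ∂μ - ε * c = α at *
    generalize S / 2 - ε * c = β at *
    linarith [show ε ^ 2 * (W * (α + β) + ε ^ 2 * (α * β))
      = (W + ε ^ 2 * α) * (W + ε ^ 2 * β) - W ^ 2 by ring]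
  have hid : Tendsto (fun ε : ℝ => ε) (𝓝[>] 0) (𝓝 0) := tendsto_nhdsWithin_of_tendsto_nhds tendsto_id
  have hα : Tendsto (fun ε => S / 2 - ∫ x, R ε x ∂μ - ε * c) (𝓝[>] 0)
      (𝓝 (S / 2 - ∫ x, D x ∂μ - 0 * c)) :=
    (tendsto_const_nhds.sub hRlim).sub (hid.mul tendsto_const_nhds)
  have hβ : Tendsto (fun ε => S / 2 - ε * c) (𝓝[>] 0) (𝓝 (S / 2 - 0 * c)) :=
    tendsto_const_nhds.sub (hid.mul tendsto_const_nhds)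
  -- As ε → 0 the two halves S / 2 add up and what remains is W * (S - ∫ D) ≤ 0.
  have hfin := le_of_tendsto (((hα.add hβ).const_mul W).add ((hid.pow 2).mul (hα.mul hβ))) hmain
  have : W * (S - ∫ x, D x ∂μ) ≤ 0 := by
    generalize ∫ x, D x ∂μ = X at hfin ⊢
    linarith
  nlinarith [le_of_mul_le_mul_left (this.trans_eq (mul_zero W).symm) hWpos]

/-! ### Poincaré inequality for strongly log-concave weights on a compact convex set. -/

section Poincare

variable {E : Type*} [MeasurableSpace E]

/-- The measure with density `exp ℓ` on the set `B` with respect to `ν`. -/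
noncomputable def expDensityOn (ν : Measure E) (B : Set E) (ℓ : E → ℝ) : Measure E :=
  (ν.restrict B).withDensity fun x => ENNReal.ofReal (Real.exp (ℓ x))

theorem ae_mem_expDensityOn {ν : Measure E} {B : Set E} {ℓ : E → ℝ} (hB : MeasurableSet B) :
    ∀ᵐ x ∂expDensityOn ν B ℓ, x ∈ B :=
  (withDensity_absolutelyContinuous _ _).ae_le (ae_restrict_mem hB)

theorem integral_expDensityOn {ν : Measure E} {B : Set E} {ℓ : E → ℝ} (hℓ : Measurable ℓ)
    (f : E → ℝ) : ∫ x, f x ∂expDensityOn ν B ℓ = ∫ x in B, f x * Real.exp (ℓ x) ∂ν := by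
  rw [expDensityOn, integral_withDensity_eq_integral_toReal_smul hℓ.exp.ennreal_ofReal
    (ae_of_all _ fun x => ENNReal.ofReal_lt_top)]
  refine integral_congr_ae (ae_of_all _ fun x => ?_)
  simp only [smul_eq_mul]
  rw [ENNReal.toReal_ofReal (Real.exp_pos _).le, mul_comm]

theorem isFiniteMeasure_expDensityOn {ν : Measure E} {B : Set E} {ℓ : E → ℝ}
    (h : IntegrableOn (fun x => Real.exp (ℓ x)) B ν) : IsFiniteMeasure (expDensityOn ν B ℓ) :=
  isFiniteMeasure_withDensity_ofReal h.2

/-- Apply Prékopa-Leindler to exp (φ + ℓ), exp (-ψ + ℓ) and exp ℓ, all cut off to B. Doubling the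
midpoint gain ρ / 8 pays exactly for the cost ρ / 4 in the constraint between φ and ψ; convexity
keeps midpoints in B. -/
theorem MidpointPrekopaLeindler.propertyTau {E : Type*} [NormedAddCommGroup E]
    [NormedSpace ℝ E] [MeasurableSpace E] {ν : Measure E} (hν : MidpointPrekopaLeindler ν)
    {B : Set E} (hB : MeasurableSet B) (hconv : Convex ℝ B) {ℓ : E → ℝ} (hℓ : Measurable ℓ)
    {ρ : ℝ} (hint : IntegrableOn (fun x => Real.exp (ℓ x)) B ν)
    (hmid : ∀ x ∈ B, ∀ y ∈ B,
      (ℓ x + ℓ y) / 2 + ρ / 8 * ‖x - y‖ ^ 2 ≤ ℓ ((1 / 2 : ℝ) • (x + y))) :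
    PropertyTau (expDensityOn ν B ℓ) B ρ := by
  intro φ ψ hφ hψ ⟨c₁, hc₁⟩ ⟨c₂, hc₂⟩ h
  have := isFiniteMeasure_expDensityOn hint
  have hlin : ∀ f : E → ℝ, Measurable f → (∃ c, ∀ x ∈ B, |f x| ≤ c) →
      ENNReal.ofReal (∫ x, Real.exp (f x) ∂expDensityOn ν B ℓ)
        = ∫⁻ x, B.indicator (fun x => ENNReal.ofReal (Real.exp (f x + ℓ x))) x ∂ν := by
    rintro f hf ⟨c, hc⟩
    rw [ofReal_integral_eq_lintegral_ofReal _ (ae_of_all _ fun x => (Real.exp_pos _).le),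
      lintegral_indicator hB, expDensityOn,
      lintegral_withDensity_eq_lintegral_mul _ hℓ.exp.ennreal_ofReal hf.exp.ennreal_ofReal]
    · refine lintegral_congr fun x => ?_
      rw [Pi.mul_apply, ← ENNReal.ofReal_mul (Real.exp_pos _).le, ← Real.exp_add, add_comm]
    · refine Integrable.of_bound hf.exp.aestronglyMeasurable (Real.exp c) ?_
      filter_upwards [ae_mem_expDensityOn hB] with x hx
      rw [Real.norm_of_nonneg (Real.exp_pos _).le]
      exact Real.exp_le_exp.2 ((le_abs_self _).trans (hc x hx))
  have h0 : ENNReal.ofReal ((expDensityOn ν B ℓ).real Set.univ)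
      = ∫⁻ x, B.indicator (fun x => ENNReal.ofReal (Real.exp (ℓ x))) x ∂ν := by
    have := hlin (fun _ => 0) measurable_const ⟨0, by simp⟩
    simpa using this
  have hind : ∀ f : E → ℝ, Measurable f →
      Measurable (B.indicator (fun x => ENNReal.ofReal (Real.exp (f x)))) :=
    fun f hf => hf.exp.ennreal_ofReal.indicator hB
  have key := hν (B.indicator (fun x => ENNReal.ofReal (Real.exp (φ x + ℓ x))))
    (B.indicator (fun x => ENNReal.ofReal (Real.exp (-ψ x + ℓ x))))
    (B.indicator (fun x => ENNReal.ofReal (Real.exp (ℓ x))))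
    (hind _ (hφ.add hℓ)) (hind _ (hψ.neg.add hℓ)) (hind _ hℓ) (fun x y => ?_)
  · rw [← hlin φ hφ ⟨c₁, hc₁⟩, ← hlin (fun x => -ψ x) hψ.neg ⟨c₂, by simpa using hc₂⟩, ← h0,
      ← ENNReal.ofReal_mul (integral_nonneg fun x => (Real.exp_pos _).le),
      ← ENNReal.ofReal_pow measureReal_nonneg,
      ENNReal.ofReal_le_ofReal_iff (by positivity)] at key
    exact key
  · by_cases hx : x ∈ B
    swap
    · simp [hx]
    by_cases hy : y ∈ B
    swap
    · simp [hy]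
    have hxy : (1 / 2 : ℝ) • (x + y) ∈ B := by
      rw [smul_add]
      exact hconv hx hy (by norm_num) (by norm_num) (by norm_num)
    rw [Set.indicator_of_mem hx, Set.indicator_of_mem hy, Set.indicator_of_mem hxy,
      ← ENNReal.ofReal_mul (Real.exp_pos _).le, ← ENNReal.ofReal_pow (Real.exp_pos _).le,
      ← Real.exp_add, ← Real.exp_nat_mul]
    refine ENNReal.ofReal_le_ofReal (Real.exp_le_exp.2 ?_)
    have h1 := hmid x hx y hy
    have h2 := h x hx y hy
    push_cast
    linarith

end Poincare

/-- For y near x the increment of g is at most about N s, with N the norm of the derivative and s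
the distance, and completing the square gives ε N s - ρ s² / 4 ≤ ε² N² / ρ. For y far from x the
Lipschitz bound ε K s loses to ρ s² / 4 once ε is small. -/
theorem eventually_infConv_defect_le {E : Type*} [NormedAddCommGroup E] [NormedSpace ℝ E]
    {B : Set E} {g : E → ℝ} {K ρ : ℝ} (hρ : 0 < ρ) {x : E}
    (hd : DifferentiableAt ℝ g x) (hK : ∀ y ∈ B, |g x - g y| ≤ K * ‖x - y‖)
    {η : ℝ} (hη : 0 < η) :
    ∀ᶠ ε in 𝓝[>] (0 : ℝ), ∀ y ∈ B, ε * (g x - g y) - ρ / 4 * ‖x - y‖ ^ 2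
      ≤ ε ^ 2 * (‖fderiv ℝ g x‖ ^ 2 / ρ + η) := by
  set N := ‖fderiv ℝ g x‖ with hN
  have hN0 : 0 ≤ N := norm_nonneg _
  obtain ⟨η', hη', hsq⟩ : ∃ η' > 0, (N + η') ^ 2 / ρ ≤ N ^ 2 / ρ + η := by
    have hc : Tendsto (fun t : ℝ => (N + t) ^ 2 / ρ) (𝓝[>] 0) (𝓝 ((N + 0) ^ 2 / ρ)) :=
      tendsto_nhdsWithin_of_tendsto_nhds (Continuous.tendsto (by fun_prop) 0)
    have := hc.eventually (gt_mem_nhds (b := (N + 0) ^ 2 / ρ) (a := N ^ 2 / ρ + η) (by simpa using hη))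
    obtain ⟨t, ht, ht0⟩ := (this.and self_mem_nhdsWithin).exists
    exact ⟨t, ht0, ht.le⟩
  have ho := hd.hasFDerivAt.isLittleO.def hη'
  obtain ⟨r, hr, hball⟩ := Metric.eventually_nhds_iff.1 ho
  have hKpos : 0 < |K| + 1 := by positivity
  -- This threshold gives ε |K| ≤ ρ r / 4 ≤ ρ s / 4 at every distance s ≥ r; the added 1 only avoids
  -- a zero denominator.
  have hsmall : ∀ᶠ ε in 𝓝[>] (0 : ℝ), ε < ρ * r / (4 * (|K| + 1)) :=
    (tendsto_nhdsWithin_of_tendsto_nhds tendsto_id).eventually (gt_mem_nhds (by positivity))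
  filter_upwards [hsmall, self_mem_nhdsWithin] with ε hεs hε y hy
  have hε : 0 < ε := hε
  set s := ‖x - y‖ with hs
  have hs0 : 0 ≤ s := norm_nonneg _
  have hgoal : 0 ≤ ε ^ 2 * (N ^ 2 / ρ + η) := by positivity
  rcases lt_or_ge s r with hsr | hsr
  · have h1 := hball (y := y) (by rw [dist_comm, dist_eq_norm]; exact hsr)
    have h2 : g x - g y ≤ (N + η') * s := by
      have h3 : |fderiv ℝ g x (y - x)| ≤ N * ‖y - x‖ := (fderiv ℝ g x).le_opNorm _
      rw [Real.norm_eq_abs] at h1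
      rw [norm_sub_rev y x] at h1 h3
      have h4 := (abs_le.1 h1).1
      have h5 := (abs_le.1 h3).1
      linarith
    calc ε * (g x - g y) - ρ / 4 * s ^ 2 ≤ ε * ((N + η') * s) - ρ / 4 * s ^ 2 := by gcongr
      _ ≤ ε ^ 2 * ((N + η') ^ 2 / ρ) := by
        rw [← mul_div_assoc, le_div_iff₀ hρ]
        nlinarith [sq_nonneg (ε * (N + η') - ρ * s / 2)]
      _ ≤ _ := by gcongr
  · refine le_trans ?_ hgoal
    have h1 : g x - g y ≤ |K| * s :=
      (le_abs_self _).trans ((hK y hy).trans (by gcongr; exact le_abs_self K))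
    rw [lt_div_iff₀ (by positivity)] at hεs
    have h2 : ε * |K| ≤ ρ / 4 * s := by nlinarith [mul_le_mul_of_nonneg_left hsr hρ.le]
    nlinarith [mul_le_mul_of_nonneg_right h2 hs0, mul_le_mul_of_nonneg_left h1 hε.le]

/-- Poincaré inequality for a strongly log-concave weight on a compact convex set. -/
theorem exists_setIntegral_sub_sq_mul_exp_le {d : ℕ} {B : Set (EuclideanSpace ℝ (Fin d))}
    (hB : IsCompact B) (hconv : Convex ℝ B) (hne : B.Nonempty)
    {ℓ g : EuclideanSpace ℝ (Fin d) → ℝ} (hℓ : ContinuousOn ℓ B) {ρ K : ℝ} (hρ : 0 < ρ)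
    (hmid : ∀ x ∈ B, ∀ y ∈ B,
      (ℓ x + ℓ y) / 2 + ρ / 8 * ‖x - y‖ ^ 2 ≤ ℓ ((1 / 2 : ℝ) • (x + y)))
    (hg : ∀ x ∈ B, DifferentiableAt ℝ g x) (hK : ∀ x ∈ B, ‖fderiv ℝ g x‖ ≤ K) :
    ∃ c, ∫ x in B, (g x - c) ^ 2 * Real.exp (ℓ x)
      ≤ ρ⁻¹ * ∫ x in B, ‖fderiv ℝ g x‖ ^ 2 * Real.exp (ℓ x) := by
  have hBm := hB.measurableSet
  have hgc : ContinuousOn g B := fun x hx => (hg x hx).continuousAt.continuousWithinAt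
  have hLip : ∀ x ∈ B, ∀ y ∈ B, |g x - g y| ≤ K * ‖x - y‖ := fun x hx y hy =>
    hconv.norm_image_sub_le_of_norm_fderiv_le hg hK hy hx
  have hind : ∀ f : EuclideanSpace ℝ (Fin d) → ℝ, ContinuousOn f B → Measurable (B.indicator f) := by
    intro f hf
    classical
    have := hf.measurable_piecewise (g := (0 : EuclideanSpace ℝ (Fin d) → ℝ))
      continuousOn_const hBm
    rwa [Set.piecewise_eq_indicator] at this
  -- Both functions are controlled only on B; extension by zero makes them measurable on the whole
  -- space without changing any integral over B.
  set ℓ' := B.indicator ℓ with hℓ'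
  set g' := B.indicator g with hg'
  have hℓe : ∀ x ∈ B, ℓ' x = ℓ x := fun x hx => Set.indicator_of_mem hx _
  have hge : ∀ x ∈ B, g' x = g x := fun x hx => Set.indicator_of_mem hx _
  have hℓm : Measurable ℓ' := hind ℓ hℓ
  have hgm : Measurable g' := hind g hgc
  have hint : IntegrableOn (fun x => Real.exp (ℓ' x)) B :=
    (hℓ.rexp.integrableOn_compact hB).congr_fun (fun x hx => by simp only [hℓe x hx]) hBm
  have hfin := isFiniteMeasure_expDensityOn hint
  set μ := expDensityOn volume B ℓ' with hμ
  have hμB : ∀ᵐ x ∂μ, x ∈ B := ae_mem_expDensityOn hBm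
  have hτ : PropertyTau μ B ρ :=
    (MidpointPrekopaLeindler.euclideanSpace_volume d).propertyTau hBm hconv hℓm hint
      fun x hx y hy => by
        have hxy : (1 / 2 : ℝ) • (x + y) ∈ B := by
          rw [smul_add]
          exact hconv hx hy (by norm_num) (by norm_num) (by norm_num)
        rw [hℓe x hx, hℓe y hy, hℓe _ hxy]
        exact hmid x hx y hy
  obtain ⟨G, hG⟩ := hB.exists_bound_of_continuousOn hgc
  set c := (∫ x, g' x ∂μ) / μ.real Set.univ with hc
  have hgi : Integrable g' μ := by
    refine Integrable.of_bound hgm.aestronglyMeasurable G ?_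
    filter_upwards [hμB] with x hx
    rw [hge x hx]
    exact hG x hx
  have hmean : ∫ x, (g' x - c) ∂μ = 0 := by
    rw [integral_sub hgi (integrable_const _), integral_const, smul_eq_mul, hc]
    rcases eq_or_ne (μ.real Set.univ) 0 with h0 | h0
    · have : μ = 0 := by
        rwa [measureReal_eq_zero_iff, Measure.measure_univ_eq_zero] at h0
      rw [this]; simp
    · field_simp
      simp
  -- The choice of D is the maximum over s of ε N s - ρ s² / 4, divided by ε², where N is the norm
  -- of the gradient; the uniform constant C replaces N by K.
  have hmain := hτ.integral_sq_le (G := G + |c|) (C := K ^ 2 / ρ) hμB hne hρ.le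
    (g := fun x => g' x - c)
    (D := fun x => ‖fderiv ℝ g x‖ ^ 2 / ρ) (hgm.sub_const c)
    (((measurable_fderiv ℝ g).norm.pow_const 2).div_const ρ)
    (fun x hx => by
      rw [hge x hx]
      exact (abs_sub _ _).trans (by gcongr; exact hG x hx))
    (fun x _ => by positivity)
    (fun x hx => by gcongr; exact hK x hx) hmean
    (fun x hx y hy ε hε => by
      rw [hge x hx, hge y hy]
      have h1 : g x - g y ≤ K * ‖x - y‖ := (le_abs_self _).trans (hLip x hx y hy)
      rw [← mul_div_assoc, le_div_iff₀ hρ]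
      have h2 : ε * (g x - g y) ≤ ε * (K * ‖x - y‖) := by gcongr
      nlinarith [sq_nonneg (ε * K - ρ * ‖x - y‖ / 2), mul_le_mul_of_nonneg_right h2 hρ.le])
    (fun x hx η hη => by
      filter_upwards [eventually_infConv_defect_le hρ (hg x hx) (hLip x hx) hη] with ε h y hy
      rw [hge x hx, hge y hy]
      have := h y hy
      linarith)
  refine ⟨c, ?_⟩
  rw [hμ, integral_expDensityOn hℓm, integral_expDensityOn hℓm] at hmain
  have e1 : ∫ x in B, (g' x - c) ^ 2 * Real.exp (ℓ' x)
      = ∫ x in B, (g x - c) ^ 2 * Real.exp (ℓ x) :=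
    setIntegral_congr_fun hBm fun x hx => by simp only [hge x hx, hℓe x hx]
  have e2 : ∫ x in B, ‖fderiv ℝ g x‖ ^ 2 / ρ * Real.exp (ℓ' x)
      = ρ⁻¹ * ∫ x in B, ‖fderiv ℝ g x‖ ^ 2 * Real.exp (ℓ x) := by
    rw [← integral_const_mul]
    exact setIntegral_congr_fun hBm fun x hx => by simp only [hℓe x hx]; ring
  rwa [e1, e2] at hmain

/-! ### Total variation and the Bhattacharyya coefficient. -/

section Hellinger

variable {α : Type*} [MeasurableSpace α] {μ : Measure α}

/-- Cauchy-Schwarz inequality for integrals of real functions. -/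
theorem sq_integral_mul_le {f g : α → ℝ} (hf : MemLp f 2 μ) (hg : MemLp g 2 μ) :
    (∫ x, f x * g x ∂μ) ^ 2 ≤ (∫ x, f x ^ 2 ∂μ) * ∫ x, g x ^ 2 ∂μ := by
  have hfg : Integrable (fun x => f x * g x) μ := hf.integrable_mul hg
  have h := discrim_le_zero (a := ∫ x, f x ^ 2 ∂μ) (b := 2 * ∫ x, f x * g x ∂μ)
    (c := ∫ x, g x ^ 2 ∂μ) fun t => by
      have e : ∫ x, (t * f x + g x) ^ 2 ∂μ = (∫ x, f x ^ 2 ∂μ) * (t * t)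
          + 2 * (∫ x, f x * g x ∂μ) * t + ∫ x, g x ^ 2 ∂μ := by
        have i1 : Integrable (fun x => t ^ 2 * f x ^ 2) μ := hf.integrable_sq.const_mul _
        have i2 : Integrable (fun x => 2 * t * (f x * g x)) μ := hfg.const_mul _
        rw [show (fun x => (t * f x + g x) ^ 2)
          = fun x => t ^ 2 * f x ^ 2 + 2 * t * (f x * g x) + g x ^ 2 by ext x; ring,
          integral_add (f := fun x => t ^ 2 * f x ^ 2 + 2 * t * (f x * g x)) (i1.add i2)
            hg.integrable_sq, integral_add i1 i2, integral_const_mul,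
          integral_const_mul]
        ring
      rw [← e]
      exact integral_nonneg fun x => sq_nonneg _
  rw [discrim] at h
  linarith

/-- With s = 1 on S and -1 off S, twice the difference of masses is the integral of s (f² - k²) = [s
(f - k)] (f + k). Cauchy-Schwarz bounds its square by (2 - 2β)(2 + 2β), where β is the integral of f
k. -/
theorem sq_setIntegral_sq_sub_le_of_integral_eq_one {f k : α → ℝ} (hf : MemLp f 2 μ)
    (hk : MemLp k 2 μ) (hf1 : ∫ x, f x ^ 2 ∂μ = 1) (hk1 : ∫ x, k x ^ 2 ∂μ = 1) {S : Set α}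
    (hS : MeasurableSet S) :
    (∫ x in S, f x ^ 2 ∂μ - ∫ x in S, k x ^ 2 ∂μ) ^ 2 ≤ 1 - (∫ x, f x * k x ∂μ) ^ 2 := by
  have hfk : Integrable (fun x => f x * k x) μ := hf.integrable_mul hk
  have if2 := hf.integrable_sq
  have ik2 := hk.integrable_sq
  have iadd : Integrable (fun x => f x ^ 2 + k x ^ 2) μ := if2.add ik2
  have isub : Integrable (fun x => f x ^ 2 - k x ^ 2) μ := if2.sub ik2
  set s : α → ℝ := fun x => S.indicator (fun _ => 2) x - 1 with hs
  have hs2 : ∀ x, s x ^ 2 = 1 := by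
    intro x
    by_cases hx : x ∈ S <;> norm_num [hs, hx]
  have hsm : Measurable s := (measurable_const.indicator hS).sub_const 1
  have e1 : ∫ x, (s x * (f x - k x)) ^ 2 ∂μ = 2 - 2 * ∫ x, f x * k x ∂μ := by
    rw [show (fun x => (s x * (f x - k x)) ^ 2) = fun x => f x ^ 2 + k x ^ 2 - 2 * (f x * k x) by
      ext x; rw [mul_pow, hs2]; ring,
      integral_sub iadd (hfk.const_mul 2), integral_add if2 ik2, integral_const_mul,
      hf1, hk1]
    ring
  have e2 : ∫ x, (f x + k x) ^ 2 ∂μ = 2 + 2 * ∫ x, f x * k x ∂μ := by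
    rw [show (fun x => (f x + k x) ^ 2) = fun x => f x ^ 2 + k x ^ 2 + 2 * (f x * k x) by
      ext x; ring,
      integral_add iadd (hfk.const_mul 2), integral_add if2 ik2, integral_const_mul,
      hf1, hk1]
    ring
  have e3 : ∫ x, s x * (f x - k x) * (f x + k x) ∂μ
      = 2 * (∫ x in S, f x ^ 2 ∂μ - ∫ x in S, k x ^ 2 ∂μ) := by
    rw [show (fun x => s x * (f x - k x) * (f x + k x))
      = fun x => S.indicator (fun x => 2 * (f x ^ 2 - k x ^ 2)) x - (f x ^ 2 - k x ^ 2) by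
      ext x
      by_cases hx : x ∈ S
      · simp only [hs, Set.indicator_of_mem hx]; ring
      · simp only [hs, Set.indicator_of_notMem hx]; ring,
      integral_sub ((isub.const_mul 2).indicator hS) isub,
      integral_indicator hS, integral_const_mul,
      integral_sub if2.integrableOn ik2.integrableOn, integral_sub if2 ik2, hf1, hk1]
    ring
  have hm : MemLp (fun x => s x * (f x - k x)) 2 μ := by
    refine (hf.sub hk).of_le (hsm.aestronglyMeasurable.mul (hf.sub hk).1) (ae_of_all _ fun x => ?_)
    have : |s x| = 1 := by
      rw [← Real.sqrt_sq_eq_abs, hs2, Real.sqrt_one]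
    rw [norm_mul, Real.norm_eq_abs (s x), this, one_mul]
    rfl
  have h := sq_integral_mul_le hm (hf.add hk)
  simp only [Pi.add_apply] at h
  rw [e1, e2, e3] at h
  nlinarith

/-- The total variation distance is bounded through the Bhattacharyya coefficient. -/
theorem sq_setIntegral_sq_div_sub_le {f k : α → ℝ} (hf : MemLp f 2 μ) (hk : MemLp k 2 μ)
    (hf0 : 0 < ∫ x, f x ^ 2 ∂μ) (hk0 : 0 < ∫ x, k x ^ 2 ∂μ) {S : Set α} (hS : MeasurableSet S) :
    ((∫ x in S, f x ^ 2 ∂μ) / (∫ x, f x ^ 2 ∂μ) - (∫ x in S, k x ^ 2 ∂μ) / ∫ x, k x ^ 2 ∂μ) ^ 2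
      ≤ 1 - (∫ x, f x * k x ∂μ) ^ 2 / ((∫ x, f x ^ 2 ∂μ) * ∫ x, k x ^ 2 ∂μ) := by
  set A := ∫ x, f x ^ 2 ∂μ with hA
  set C := ∫ x, k x ^ 2 ∂μ with hC
  have sA : √A ^ 2 = A := Real.sq_sqrt hf0.le
  have sC : √C ^ 2 = C := Real.sq_sqrt hk0.le
  have h := sq_setIntegral_sq_sub_le_of_integral_eq_one (hf.const_mul (√A)⁻¹)
    (hk.const_mul (√C)⁻¹) (by
      simp only [mul_pow, inv_pow, sA]
      rw [integral_const_mul, ← hA, inv_mul_cancel₀ hf0.ne']) (by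
      simp only [mul_pow, inv_pow, sC]
      rw [integral_const_mul, ← hC, inv_mul_cancel₀ hk0.ne']) hS
  simp only [mul_pow, inv_pow, sA, sC] at h
  rw [integral_const_mul, integral_const_mul] at h
  have e : ∫ x, (√A)⁻¹ * f x * ((√C)⁻¹ * k x) ∂μ = (√A)⁻¹ * (√C)⁻¹ * ∫ x, f x * k x ∂μ := by
    rw [← integral_const_mul]
    congr 1
    ext x
    ring
  rw [e, mul_pow, mul_pow, inv_pow, inv_pow, sA, sC] at h
  rw [div_eq_inv_mul, div_eq_inv_mul, div_eq_inv_mul, mul_inv]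
  exact h

end Hellinger

/-! ### Total variation bounded by relative Fisher information. -/

/-- Comparison, on a compact convex set `B`, of the density proportional to `exp v` with the
density proportional to `p * exp ℓ`, where `ℓ` is strongly concave and `p` is bounded above and
below. -/
theorem sq_setIntegral_exp_div_sub_le {d : ℕ} {B : Set (EuclideanSpace ℝ (Fin d))}
    (hB : IsCompact B) (hconv : Convex ℝ B) (hvol : volume B ≠ 0)
    {ℓ v p : EuclideanSpace ℝ (Fin d) → ℝ} {ρ K m M : ℝ} (hρ : 0 < ρ)
    (hmid : ∀ x ∈ B, ∀ y ∈ B,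
      (ℓ x + ℓ y) / 2 + ρ / 8 * ‖x - y‖ ^ 2 ≤ ℓ ((1 / 2 : ℝ) • (x + y)))
    (hℓ : ∀ x ∈ B, DifferentiableAt ℝ ℓ x) (hv : ∀ x ∈ B, DifferentiableAt ℝ v x)
    (hp : ∀ x ∈ B, DifferentiableAt ℝ p x) (hm : 0 < m) (hpm : ∀ x ∈ B, m ≤ p x)
    (hpM : ∀ x ∈ B, p x ≤ M)
    (hK : ∀ x ∈ B, ‖fderiv ℝ v x - fderiv ℝ ℓ x - (p x)⁻¹ • fderiv ℝ p x‖ ≤ K)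
    {S : Set (EuclideanSpace ℝ (Fin d))} (hS : MeasurableSet S) :
    ((∫ x in S ∩ B, Real.exp (v x)) / (∫ x in B, Real.exp (v x))
      - (∫ x in S ∩ B, Real.exp (ℓ x) * p x) / ∫ x in B, Real.exp (ℓ x) * p x) ^ 2
      ≤ M / (4 * ρ * m) *
        ((∫ x in B, ‖fderiv ℝ v x - fderiv ℝ ℓ x - (p x)⁻¹ • fderiv ℝ p x‖ ^ 2 * Real.exp (v x))
          / ∫ x in B, Real.exp (v x)) := by
  have hBm := hB.measurableSet
  have hne : B.Nonempty := by
    rw [Set.nonempty_iff_ne_empty]; rintro rfl; simp at hvol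
  have hppos : ∀ x ∈ B, 0 < p x := fun x hx => hm.trans_le (hpm x hx)
  have hℓc : ContinuousOn ℓ B := fun x hx => (hℓ x hx).continuousAt.continuousWithinAt
  have hvc : ContinuousOn v B := fun x hx => (hv x hx).continuousAt.continuousWithinAt
  have hpc : ContinuousOn p B := fun x hx => (hp x hx).continuousAt.continuousWithinAt
  set N := fun x => ‖fderiv ℝ v x - fderiv ℝ ℓ x - (p x)⁻¹ • fderiv ℝ p x‖ with hN
  -- The square root of the ratio of exp v to p * exp ℓ: its integral against q is the Bhattacharyya
  -- integral, and its logarithmic gradient is half the difference of the scores.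
  set g := fun x => Real.exp ((1 / 2) * (v x - ℓ x - Real.log (p x))) with hg
  have hgd : ∀ x ∈ B, HasFDerivAt g (g x • ((1 / 2 : ℝ) •
      (fderiv ℝ v x - fderiv ℝ ℓ x - (p x)⁻¹ • fderiv ℝ p x))) x := fun x hx =>
    ((((hv x hx).hasFDerivAt.sub (hℓ x hx).hasFDerivAt).sub
      ((hp x hx).hasFDerivAt.log (hppos x hx).ne')).const_mul (1 / 2)).exp
  have hgn : ∀ x ∈ B, ‖fderiv ℝ g x‖ = g x / 2 * N x := by
    intro x hx
    rw [(hgd x hx).fderiv, norm_smul, norm_smul, Real.norm_of_nonneg (Real.exp_pos _).le,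
      Real.norm_of_nonneg (by norm_num)]
    ring
  have hgc : ContinuousOn g B := fun x hx => (hgd x hx).continuousAt.continuousWithinAt
  obtain ⟨G, hG⟩ := hB.exists_bound_of_continuousOn hgc
  have hg2 : ∀ x ∈ B, g x ^ 2 * (Real.exp (ℓ x) * p x) = Real.exp (v x) := by
    intro x hx
    rw [hg, ← Real.exp_nat_mul]
    nth_rw 2 [← Real.exp_log (hppos x hx)]
    rw [← Real.exp_add, ← Real.exp_add]
    congr 1
    push_cast
    ring
  -- The weight is exp ℓ, because p is not assumed log-concave. Passing to q costs p ≤ M on the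
  -- variance side and m ≤ p on the energy side; together with the squared factor 1/2 this makes M /
  -- (4 ρ m).
  obtain ⟨c, hc⟩ := exists_setIntegral_sub_sq_mul_exp_le hB hconv hne hℓc (K := G / 2 * K) hρ hmid
    (fun x hx => (hgd x hx).differentiableAt) (fun x hx => by
      have h0 : 0 ≤ g x := (Real.exp_pos _).le
      have hGx : g x ≤ G := (le_abs_self _).trans (hG x hx)
      rw [hgn x hx]
      exact mul_le_mul (by linarith) (hK x hx) (norm_nonneg _) (by linarith))
  -- integrability
  have hM : 0 < M := by
    obtain ⟨x, hx⟩ := hne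
    exact (hppos x hx).trans_le (hpM x hx)
  set γ := fun x => Real.exp (v x) with hγ
  set q := fun x => Real.exp (ℓ x) * p x with hq
  have iγ : IntegrableOn γ B := hvc.rexp.integrableOn_compact hB
  have hqc : ContinuousOn q B := hℓc.rexp.mul hpc
  have iq : IntegrableOn q B := hqc.integrableOn_compact hB
  have igq : IntegrableOn (fun x => g x * q x) B := (hgc.mul hqc).integrableOn_compact hB
  have hqpos : ∀ x ∈ B, 0 < q x := fun x hx => mul_pos (Real.exp_pos _) (hppos x hx)
  have hpos : ∀ f : EuclideanSpace ℝ (Fin d) → ℝ, IntegrableOn f B → (∀ x ∈ B, 0 < f x) →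
      0 < ∫ x in B, f x := by
    intro f hf hfpos
    rw [setIntegral_pos_iff_support_of_nonneg_ae _ hf]
    · rw [Set.inter_eq_right.2 (show B ⊆ Function.support f from fun x hx => (hfpos x hx).ne')]
      exact pos_iff_ne_zero.2 hvol
    · filter_upwards [ae_restrict_mem hBm] with x hx using (hfpos x hx).le
  have Zγ : 0 < ∫ x in B, γ x := hpos γ iγ fun x _ => Real.exp_pos _
  have Zq : 0 < ∫ x in B, q x := hpos q iq hqpos
  set H := ∫ x in B, g x * q x with hH
  -- Poincaré with respect to the weight `q`
  have hmono : ∫ x in B, (g x - c) ^ 2 * q x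
      ≤ M / (4 * ρ * m) * ∫ x in B, N x ^ 2 * γ x := by
    have i1 : IntegrableOn (fun x => (g x - c) ^ 2 * Real.exp (ℓ x)) B :=
      (((hgc.sub continuousOn_const).pow 2).mul hℓc.rexp).integrableOn_compact hB
    have i2 : IntegrableOn (fun x => (g x - c) ^ 2 * q x) B :=
      (((hgc.sub continuousOn_const).pow 2).mul hqc).integrableOn_compact hB
    have i3 : IntegrableOn (fun x => N x ^ 2 * γ x) B := by
      have hNm : AEStronglyMeasurable N (volume.restrict B) := by
        refine AEStronglyMeasurable.norm ?_
        refine ((measurable_fderiv ℝ v).sub (measurable_fderiv ℝ ℓ)).aestronglyMeasurable.sub ?_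
        exact (hpc.inv₀ fun x hx => (hppos x hx).ne').aestronglyMeasurable hBm |>.smul
          (measurable_fderiv ℝ p).aestronglyMeasurable
      refine Integrable.bdd_mul iγ (c := K ^ 2) (hNm.pow 2) ?_
      filter_upwards [ae_restrict_mem hBm] with x hx
      rw [Real.norm_of_nonneg (sq_nonneg _)]
      exact pow_le_pow_left₀ (norm_nonneg _) (hK x hx) 2
    have i4 : IntegrableOn (fun x => ‖fderiv ℝ g x‖ ^ 2 * Real.exp (ℓ x)) B := by
      refine Integrable.bdd_mul (hℓc.rexp.integrableOn_compact hB) (c := (G / 2 * K) ^ 2)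
        ((measurable_fderiv ℝ g).norm.pow_const 2).aestronglyMeasurable ?_
      filter_upwards [ae_restrict_mem hBm] with x hx
      rw [Real.norm_of_nonneg (sq_nonneg _)]
      refine pow_le_pow_left₀ (norm_nonneg _) ?_ 2
      have h0 : 0 ≤ g x := (Real.exp_pos _).le
      have hGx : g x ≤ G := (le_abs_self _).trans (hG x hx)
      rw [hgn x hx]
      exact mul_le_mul (by linarith) (hK x hx) (norm_nonneg _) (by linarith)
    calc ∫ x in B, (g x - c) ^ 2 * q x
        ≤ ∫ x in B, M * ((g x - c) ^ 2 * Real.exp (ℓ x)) := by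
          refine setIntegral_mono_on i2 (i1.const_mul M) hBm fun x hx => ?_
          rw [hq]
          have := mul_le_mul_of_nonneg_left (hpM x hx)
            (mul_nonneg (sq_nonneg (g x - c)) (Real.exp_pos (ℓ x)).le)
          linarith
      _ = M * ∫ x in B, (g x - c) ^ 2 * Real.exp (ℓ x) := integral_const_mul _ _
      _ ≤ M * (ρ⁻¹ * ∫ x in B, ‖fderiv ℝ g x‖ ^ 2 * Real.exp (ℓ x)) := by gcongr
      _ ≤ M * (ρ⁻¹ * ∫ x in B, (4 * m)⁻¹ * (N x ^ 2 * γ x)) := by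
          refine mul_le_mul_of_nonneg_left (mul_le_mul_of_nonneg_left ?_ (inv_pos.2 hρ).le) hM.le
          refine setIntegral_mono_on i4 (i3.const_mul _) hBm fun x hx => ?_
          rw [hgn x hx, show γ x = g x ^ 2 * (Real.exp (ℓ x) * p x) from (hg2 x hx).symm, mul_pow,
            div_pow]
          have h1 : (4 * m)⁻¹ * (N x ^ 2 * (g x ^ 2 * (Real.exp (ℓ x) * p x)))
            = (g x ^ 2 / 2 ^ 2 * N x ^ 2 * Real.exp (ℓ x)) * (p x / m) := by
            field_simp; ring
          rw [h1]
          exact le_mul_of_one_le_right (by positivity) ((one_le_div hm).2 (hpm x hx))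
      _ = M / (4 * ρ * m) * ∫ x in B, N x ^ 2 * γ x := by
          rw [integral_const_mul]; field_simp
  have hexpand : ∫ x in B, (g x - c) ^ 2 * q x
      = (∫ x in B, γ x) - 2 * c * H + c ^ 2 * ∫ x in B, q x := by
    have i5 : IntegrableOn (fun x => γ x - 2 * c * (g x * q x)) B := iγ.sub (igq.const_mul _)
    rw [hH, ← integral_const_mul, ← integral_const_mul, ← integral_sub iγ (igq.const_mul _),
      ← integral_add i5 (iq.const_mul _)]
    refine setIntegral_congr_fun hBm fun x hx => ?_
    have h1 : γ x = g x ^ 2 * q x := (hg2 x hx).symm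
    simp only [h1]
    ring
  -- Hellinger bound
  have hsq : ∀ f : EuclideanSpace ℝ (Fin d) → ℝ, ContinuousOn f B →
      MemLp (fun x => √(f x)) 2 (volume.restrict B) := by
    intro f hf
    rw [memLp_two_iff_integrable_sq (hf.sqrt.aestronglyMeasurable hBm)]
    exact (hf.sqrt.pow 2).integrableOn_compact hB
  have hell := sq_setIntegral_sq_div_sub_le (hsq γ hvc.rexp) (hsq q hqc)
    (by rwa [setIntegral_congr_fun (g := γ) hBm fun x hx => Real.sq_sqrt (Real.exp_pos _).le])
    (by rwa [setIntegral_congr_fun (g := q) hBm fun x hx => Real.sq_sqrt (hqpos x hx).le]) hS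
  rw [Measure.restrict_restrict hS,
    setIntegral_congr_fun (g := γ) hBm fun x hx => Real.sq_sqrt (Real.exp_pos _).le,
    setIntegral_congr_fun (g := q) hBm fun x hx => Real.sq_sqrt (hqpos x hx).le,
    setIntegral_congr_fun (g := γ) (hS.inter hBm) fun x hx => Real.sq_sqrt (Real.exp_pos _).le,
    setIntegral_congr_fun (g := q) (hS.inter hBm) fun x hx => Real.sq_sqrt (hqpos x hx.2).le] at hell
  have hH' : ∫ x in B, √(γ x) * √(q x) = H := by
    refine setIntegral_congr_fun hBm fun x hx => ?_
    have h1 : √(γ x) = g x * √(q x) := by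
      rw [show γ x = g x ^ 2 * q x from (hg2 x hx).symm, Real.sqrt_mul (sq_nonneg _),
        Real.sqrt_sq (Real.exp_pos _).le]
    change √(γ x) * √(q x) = g x * q x
    rw [h1, mul_assoc, Real.mul_self_sqrt (hqpos x hx).le]
  rw [hH'] at hell
  refine hell.trans ?_
  rw [hexpand] at hmono
  set Z₁ := ∫ x in B, γ x
  set Z₂ := ∫ x in B, q x
  set X := ∫ x in B, N x ^ 2 * γ x
  rw [← mul_div_assoc, le_div_iff₀ Zγ]
  refine le_trans ?_ hmono
  have h1 : (1 - H ^ 2 / (Z₁ * Z₂)) * Z₁ = Z₁ - H ^ 2 / Z₂ := by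
    field_simp
  rw [h1]
  -- The constant c need not be the mean of g under q. As a quadratic in c, the expansion is
  -- smallest at H / Z₂, with value Z₁ - H ^ 2 / Z₂.
  have h2 : 0 ≤ (c * Z₂ - H) ^ 2 / Z₂ := by positivity
  have h3 : (c * Z₂ - H) ^ 2 / Z₂ = c ^ 2 * Z₂ - 2 * c * H + H ^ 2 / Z₂ := by
    field_simp; ring
  linarith

/-! ### Gaussian integrals: tails, fourth moment, characteristic function. -/

section GaussianIntegrals

variable {d : ℕ} (b : OrthonormalBasis (Fin d) ℝ (EuclideanSpace ℝ (Fin d)))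

theorem OrthonormalBasis.measurePreserving_coords :
    MeasurePreserving (fun h => (b.repr h).ofLp : EuclideanSpace ℝ (Fin d) → Fin d → ℝ) :=
  (PiLp.volume_preserving_ofLp (Fin d)).comp b.measurePreserving_repr

theorem OrthonormalBasis.measurableEmbedding_coords :
    MeasurableEmbedding (fun h => (b.repr h).ofLp : EuclideanSpace ℝ (Fin d) → Fin d → ℝ) :=
  ((MeasurableEquiv.toLp 2 (Fin d → ℝ)).symm.measurableEmbedding).comp
    b.repr.toHomeomorph.measurableEmbedding

theorem OrthonormalBasis.integral_prod_coords {𝕜 : Type*} [RCLike 𝕜] (f : Fin d → ℝ → 𝕜) :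
    ∫ h, ∏ i, f i (b.repr h i) = ∏ i, ∫ x, f i x := by
  rw [← integral_fintype_prod_volume_eq_prod]
  exact b.measurePreserving_coords.integral_comp b.measurableEmbedding_coords
    (fun y => ∏ i, f i (y i))

theorem OrthonormalBasis.integrable_prod_coords {f : Fin d → ℝ → ℝ} (hf : ∀ i, Integrable (f i)) :
    Integrable fun h => ∏ i, f i (b.repr h i) :=
  (b.measurePreserving_coords.integrable_comp_emb b.measurableEmbedding_coords
    (g := fun y => ∏ i, f i (y i))).2 (Integrable.fintype_prod hf)

theorem OrthonormalBasis.norm_sq_eq_sum_coords (h : EuclideanSpace ℝ (Fin d)) :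
    ‖h‖ ^ 2 = ∑ i, (b.repr h i) ^ 2 := by
  rw [← b.repr.norm_map h, EuclideanSpace.real_norm_sq_eq]

/-- The quadratic form which is diagonal in the orthonormal basis `b`, with coefficients `a`. -/
noncomputable def diagForm (a : Fin d → ℝ) (h : EuclideanSpace ℝ (Fin d)) : ℝ :=
  ∑ i, a i * (b.repr h i) ^ 2

variable {b} {a : Fin d → ℝ}

theorem continuous_diagForm : Continuous (diagForm b a) := by
  unfold diagForm
  fun_prop

theorem exp_neg_diagForm (h : EuclideanSpace ℝ (Fin d)) :
    Real.exp (-(1 / 2) * diagForm b a h)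
      = ∏ i, Real.exp (-(a i / 2) * (b.repr h i) ^ 2) := by
  rw [← Real.exp_sum, diagForm, Finset.mul_sum]
  congr 1
  exact Finset.sum_congr rfl fun i _ => by ring

theorem integrable_exp_neg_diagForm (ha : ∀ i, 0 < a i) :
    Integrable fun h => Real.exp (-(1 / 2) * diagForm b a h) := by
  simp_rw [exp_neg_diagForm]
  exact b.integrable_prod_coords fun i => integrable_exp_neg_mul_sq (half_pos (ha i))

theorem integral_exp_neg_diagForm :
    ∫ h, Real.exp (-(1 / 2) * diagForm b a h) = ∏ i, √(2 * Real.pi / a i) := by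
  simp_rw [exp_neg_diagForm]
  rw [b.integral_prod_coords (fun i x => Real.exp (-(a i / 2) * x ^ 2))]
  refine Finset.prod_congr rfl fun i _ => ?_
  rw [integral_gaussian]
  congr 1
  rw [div_div_eq_mul_div, mul_comm]

theorem integral_exp_neg_diagForm_pos (ha : ∀ i, 0 < a i) :
    0 < ∫ h, Real.exp (-(1 / 2) * diagForm b a h) := by
  rw [integral_exp_neg_diagForm]
  exact Finset.prod_pos fun i _ => Real.sqrt_pos.2 (div_pos (by positivity) (ha i))

/-- Bounds each factor of the Laplace transform of ‖h‖² by an exponential linear in the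
corresponding variance, with a denominator common to all coordinates. -/
theorem inv_one_sub_le_exp {x y : ℝ} (hx : 0 ≤ x) (hxy : x ≤ y) (hy : y < 1) :
    (1 - x)⁻¹ ≤ Real.exp (x / (1 - y)) := by
  have h1 : 0 < 1 - x := by linarith
  have h2 : 0 < 1 - y := by linarith
  calc (1 - x)⁻¹ = x / (1 - x) + 1 := by field_simp; ring
    _ ≤ x / (1 - y) + 1 := by gcongr
    _ ≤ _ := Real.add_one_le_exp _

/-- Gaussian concentration of the Euclidean norm. -/
theorem setIntegral_exp_neg_diagForm_le (ha : ∀ i, 0 < a i) {σ r : ℝ} (hσ : 0 < σ)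
    (haσ : ∀ i, (a i)⁻¹ ≤ σ) (hr : √(∑ i, (a i)⁻¹) < r) :
    ∫ h in {h | r < ‖h‖}, Real.exp (-(1 / 2) * diagForm b a h)
      ≤ Real.exp (-(1 / 2) * (r - √(∑ i, (a i)⁻¹)) ^ 2 * σ⁻¹)
        * ∫ h, Real.exp (-(1 / 2) * diagForm b a h) := by
  set t := √(∑ i, (a i)⁻¹) with ht
  have hT0 : 0 ≤ ∑ i, (a i)⁻¹ := Finset.sum_nonneg fun i _ => (inv_pos.2 (ha i)).le
  have ht2 : t ^ 2 = ∑ i, (a i)⁻¹ := Real.sq_sqrt hT0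
  have ht0 : 0 ≤ t := Real.sqrt_nonneg _
  have hr0 : 0 < r := ht0.trans_lt hr
  -- The optimal Chernoff parameter: the exponent -s r² + s t² / (1 - 2 s σ) is minimized when 1 - 2
  -- s σ = t / r, with value -(r - t)² / (2σ).
  set s := (1 - t / r) / (2 * σ) with hs
  have htr : t / r < 1 := (div_lt_one hr0).2 hr
  have hs0 : 0 < s := div_pos (by linarith) (by positivity)
  have h2s : 1 - 2 * s * σ = t / r := by
    rw [hs]; field_simp; ring
  -- An index is required because t = 0 in dimension zero, where the products over coordinates are
  -- empty.
  have htpos : ∀ _ : Fin d, 0 < t := fun i => Real.sqrt_pos.2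
    (Finset.sum_pos (fun j _ => inv_pos.2 (ha j)) ⟨i, Finset.mem_univ i⟩)
  have hsa : ∀ i, 0 < a i - 2 * s := by
    intro i
    have h1 : 0 < 1 - 2 * s * σ := h2s ▸ div_pos (htpos i) hr0
    have h2 : 1 ≤ a i * σ := by
      have := mul_le_mul_of_nonneg_left (haσ i) (ha i).le
      rwa [mul_inv_cancel₀ (ha i).ne'] at this
    by_contra hcon
    have := mul_le_mul_of_nonneg_right (not_lt.1 hcon) hσ.le
    nlinarith
  have hform : ∀ h, Real.exp (s * ‖h‖ ^ 2) * Real.exp (-(1 / 2) * diagForm b a h)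
      = Real.exp (-(1 / 2) * diagForm b (fun i => a i - 2 * s) h) := by
    intro h
    rw [← Real.exp_add, b.norm_sq_eq_sum_coords, diagForm, diagForm, Finset.mul_sum,
      Finset.mul_sum, Finset.mul_sum, ← Finset.sum_add_distrib]
    congr 1
    exact Finset.sum_congr rfl fun i _ => by ring
  have hi := integrable_exp_neg_diagForm (b := b) ha
  have hi' := integrable_exp_neg_diagForm (b := b) hsa
  have hfac : ∀ i, √(2 * Real.pi / (a i - 2 * s))
      ≤ √(2 * Real.pi / a i) * Real.exp (s * (r / t) * (a i)⁻¹) := by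
    intro i
    have hai := ha i
    have hai' := hsa i
    have h1 := inv_one_sub_le_exp (x := 2 * s * (a i)⁻¹) (y := 2 * s * σ) (by positivity)
      (by gcongr; exact haσ i) (by have := div_pos (htpos i) hr0; linarith)
    rw [h2s] at h1
    refine Real.sqrt_le_iff.2 ⟨by positivity, ?_⟩
    rw [mul_pow, Real.sq_sqrt (by positivity), ← Real.exp_nat_mul]
    calc 2 * Real.pi / (a i - 2 * s) = 2 * Real.pi / a i * (1 - 2 * s * (a i)⁻¹)⁻¹ := by
          have : a i - 2 * s ≠ 0 := hai'.ne'
          have e : 1 - 2 * s * (a i)⁻¹ = (a i - 2 * s) / a i := by field_simp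
          rw [e]; field_simp
      _ ≤ 2 * Real.pi / a i * Real.exp (2 * s * (a i)⁻¹ / (t / r)) := by gcongr
      _ = _ := by
          congr 2
          push_cast
          field_simp
  calc ∫ h in {h | r < ‖h‖}, Real.exp (-(1 / 2) * diagForm b a h)
      ≤ ∫ h in {h | r < ‖h‖}, Real.exp (-s * r ^ 2)
          * Real.exp (-(1 / 2) * diagForm b (fun i => a i - 2 * s) h) := by
        refine setIntegral_mono_on hi.integrableOn (hi'.const_mul _).integrableOn
          (measurableSet_lt measurable_const measurable_norm) fun h hh => ?_
        rw [← hform, ← mul_assoc, ← Real.exp_add]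
        refine le_mul_of_one_le_left (Real.exp_pos _).le (Real.one_le_exp ?_)
        have : r ^ 2 ≤ ‖h‖ ^ 2 := pow_le_pow_left₀ hr0.le (le_of_lt hh) 2
        nlinarith
    _ ≤ ∫ h, Real.exp (-s * r ^ 2)
          * Real.exp (-(1 / 2) * diagForm b (fun i => a i - 2 * s) h) :=
        setIntegral_le_integral (hi'.const_mul _) (ae_of_all _ fun h => by positivity)
    _ = Real.exp (-s * r ^ 2) * ∏ i, √(2 * Real.pi / (a i - 2 * s)) := by
        rw [integral_const_mul, integral_exp_neg_diagForm]
    _ ≤ Real.exp (-s * r ^ 2)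
          * ∏ i, (√(2 * Real.pi / a i) * Real.exp (s * (r / t) * (a i)⁻¹)) := by
        gcongr with i
        exact hfac i
    _ = Real.exp (-s * r ^ 2 + s * (r / t) * ∑ i, (a i)⁻¹) * ∏ i, √(2 * Real.pi / a i) := by
        rw [Finset.prod_mul_distrib, ← Real.exp_sum, ← Finset.mul_sum, Real.exp_add]
        ring
    _ = _ := by
        rw [integral_exp_neg_diagForm, ← ht2]
        congr 2
        have e : r / t * t ^ 2 = r * t := by
          rcases eq_or_ne t 0 with h0 | h0
          · simp [h0]
          · field_simp
        rw [mul_assoc s, e, hs]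
        field_simp
        ring

theorem integral_pow_four_mul_exp_neg_mul_sq {c : ℝ} (hc : 0 < c) :
    ∫ x : ℝ, x ^ 4 * Real.exp (-(c / 2) * x ^ 2) = 3 / c ^ 2 * √(2 * Real.pi / c) := by
  have h1 : ∫ x : ℝ, x ^ 4 * Real.exp (-(c / 2) * x ^ 2)
      = 2 * ∫ x in Set.Ioi (0 : ℝ), x ^ 4 * Real.exp (-(c / 2) * x ^ 2) := by
    rw [← integral_comp_abs (f := fun x => x ^ 4 * Real.exp (-(c / 2) * x ^ 2))]
    simp [Even.pow_abs (show Even 4 by decide)]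
  have h2 := integral_rpow_mul_exp_neg_mul_rpow (p := 2) (q := 4) (b := c / 2) (by norm_num)
    (by norm_num) (by positivity)
  have h3 : ∫ x in Set.Ioi (0 : ℝ), x ^ (4 : ℝ) * Real.exp (-(c / 2) * x ^ (2 : ℝ))
      = ∫ x in Set.Ioi (0 : ℝ), x ^ 4 * Real.exp (-(c / 2) * x ^ 2) := by
    refine setIntegral_congr_fun measurableSet_Ioi fun x _ => ?_
    norm_cast
  have hG : Real.Gamma ((4 + 1) / 2) = 3 / 4 * √Real.pi := by
    rw [show ((4 : ℝ) + 1) / 2 = (1 / 2 + 1) + 1 by norm_num, Real.Gamma_add_one (by norm_num),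
      Real.Gamma_add_one (by norm_num), Real.Gamma_one_half_eq]
    ring
  rw [h1, ← h3, h2, hG, show -(4 + 1 : ℝ) / 2 = -(2 : ℝ) + -(1 / 2) by norm_num,
    Real.rpow_add (by positivity), Real.rpow_neg (by positivity), Real.rpow_neg (by positivity),
    ← Real.sqrt_eq_rpow, show 2 * Real.pi / c = Real.pi / (c / 2) by field_simp,
    Real.sqrt_div Real.pi_pos.le]
  have : (c / 2) ^ (2 : ℝ) = (c / 2) ^ 2 := by norm_cast
  rw [this]
  field_simp
  norm_num

theorem integrable_pow_four_mul_exp_neg_mul_sq {c : ℝ} (hc : 0 < c) :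
    Integrable fun x : ℝ => x ^ 4 * Real.exp (-(c / 2) * x ^ 2) := by
  have := integrable_rpow_mul_exp_neg_mul_sq (b := c / 2) (by positivity) (s := 4) (by norm_num)
  norm_cast at this

theorem coord_pow_four_mul_exp_neg_diagForm (j : Fin d) (h : EuclideanSpace ℝ (Fin d)) :
    (b.repr h j) ^ 4 * Real.exp (-(1 / 2) * diagForm b a h)
      = ∏ i, (if i = j then (b.repr h i) ^ 4 else 1) * Real.exp (-(a i / 2) * (b.repr h i) ^ 2) := by
  rw [exp_neg_diagForm, Finset.prod_mul_distrib]
  simp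

theorem integrable_coord_pow_four (ha : ∀ i, 0 < a i) (j : Fin d) :
    Integrable fun h => (b.repr h j) ^ 4 * Real.exp (-(1 / 2) * diagForm b a h) := by
  simp_rw [coord_pow_four_mul_exp_neg_diagForm]
  refine b.integrable_prod_coords
    (f := fun i x => (if i = j then x ^ 4 else 1) * Real.exp (-(a i / 2) * x ^ 2)) fun i => ?_
  by_cases hij : i = j
  · simpa [hij] using integrable_pow_four_mul_exp_neg_mul_sq (ha j)
  · simpa [hij] using integrable_exp_neg_mul_sq (half_pos (ha i))

theorem integral_coord_pow_four (ha : ∀ i, 0 < a i) (j : Fin d) :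
    ∫ h, (b.repr h j) ^ 4 * Real.exp (-(1 / 2) * diagForm b a h)
      = 3 / a j ^ 2 * ∫ h, Real.exp (-(1 / 2) * diagForm b a h) := by
  simp_rw [coord_pow_four_mul_exp_neg_diagForm]
  rw [b.integral_prod_coords
    (fun i x => (if i = j then x ^ 4 else 1) * Real.exp (-(a i / 2) * x ^ 2)),
    integral_exp_neg_diagForm]
  have : ∀ i, ∫ x, (if i = j then x ^ 4 else 1) * Real.exp (-(a i / 2) * x ^ 2)
      = (if i = j then 3 / a j ^ 2 else 1) * √(2 * Real.pi / a i) := by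
    intro i
    by_cases hij : i = j
    · subst hij
      simpa using integral_pow_four_mul_exp_neg_mul_sq (ha i)
    · simp only [hij, if_false, one_mul]
      rw [integral_gaussian]
      congr 1
      rw [div_div_eq_mul_div, mul_comm]
  rw [Finset.prod_congr rfl fun i _ => this i, Finset.prod_mul_distrib]
  simp

/-- Cauchy-Schwarz for ‖h‖² = Σ aᵢ^(-1/2) (aᵢ^(1/2) hᵢ²). With these weights each aᵢ hᵢ⁴ has
Gaussian mean 3 / aᵢ, so the fourth moment is at most three times the squared trace of the
covariance. -/
theorem norm_pow_four_le (ha : ∀ i, 0 < a i) (h : EuclideanSpace ℝ (Fin d)) :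
    ‖h‖ ^ 4 ≤ (∑ i, (a i)⁻¹) * ∑ i, a i * (b.repr h i) ^ 4 := by
  rw [show ‖h‖ ^ 4 = (‖h‖ ^ 2) ^ 2 by ring, b.norm_sq_eq_sum_coords]
  refine Finset.sum_sq_le_sum_mul_sum_of_sq_le_mul _ (fun i _ => (inv_pos.2 (ha i)).le)
    (fun i _ => mul_nonneg (ha i).le (by positivity)) fun i _ => le_of_eq ?_
  rw [← mul_assoc, inv_mul_cancel₀ (ha i).ne']
  ring

theorem integrable_norm_pow_four_mul_exp_neg_diagForm (ha : ∀ i, 0 < a i) :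
    Integrable fun h => ‖h‖ ^ 4 * Real.exp (-(1 / 2) * diagForm b a h) := by
  have hi : Integrable fun h => (∑ i, (a i)⁻¹)
      * ∑ i, a i * ((b.repr h i) ^ 4 * Real.exp (-(1 / 2) * diagForm b a h)) :=
    (integrable_finsetSum _ fun i _ => (integrable_coord_pow_four ha i).const_mul _).const_mul _
  refine hi.mono' ?_ (ae_of_all _ fun h => ?_)
  · have := continuous_diagForm (b := b) (a := a)
    exact Continuous.aestronglyMeasurable (by fun_prop)
  · rw [Real.norm_of_nonneg (by positivity)]
    calc _ ≤ ((∑ i, (a i)⁻¹) * ∑ i, a i * (b.repr h i) ^ 4)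
          * Real.exp (-(1 / 2) * diagForm b a h) := by
          gcongr; exact norm_pow_four_le ha h
      _ = _ := by
          simp only [mul_assoc, Finset.sum_mul]

theorem integral_norm_pow_four_mul_exp_neg_diagForm_le (ha : ∀ i, 0 < a i) :
    ∫ h, ‖h‖ ^ 4 * Real.exp (-(1 / 2) * diagForm b a h)
      ≤ 3 * (∑ i, (a i)⁻¹) ^ 2 * ∫ h, Real.exp (-(1 / 2) * diagForm b a h) := by
  have hi : ∀ i, Integrable fun h =>
      a i * ((b.repr h i) ^ 4 * Real.exp (-(1 / 2) * diagForm b a h)) :=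
    fun i => (integrable_coord_pow_four ha i).const_mul _
  calc ∫ h, ‖h‖ ^ 4 * Real.exp (-(1 / 2) * diagForm b a h)
      ≤ ∫ h, (∑ i, (a i)⁻¹)
          * ∑ i, a i * ((b.repr h i) ^ 4 * Real.exp (-(1 / 2) * diagForm b a h)) := by
        refine integral_mono (integrable_norm_pow_four_mul_exp_neg_diagForm ha)
          ((integrable_finsetSum _ fun i _ => hi i).const_mul _) fun h => ?_
        calc _ ≤ ((∑ i, (a i)⁻¹) * ∑ i, a i * (b.repr h i) ^ 4)
              * Real.exp (-(1 / 2) * diagForm b a h) := by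
              gcongr; exact norm_pow_four_le ha h
          _ = _ := by
              simp only [mul_assoc, Finset.sum_mul]
    _ = _ := by
        rw [integral_const_mul, integral_finsetSum _ fun i _ => hi i]
        simp_rw [integral_const_mul, integral_coord_pow_four ha]
        have : ∀ i, a i * (3 / a i ^ 2 * ∫ h, Real.exp (-(1 / 2) * diagForm b a h))
            = (a i)⁻¹ * (3 * ∫ h, Real.exp (-(1 / 2) * diagForm b a h)) := fun i => by
          have := (ha i).ne'
          field_simp
        rw [Finset.sum_congr rfl fun i _ => this i, ← Finset.sum_mul]
        ring

/-- The centered Gaussian measure with precision form `diagForm b a`. -/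
noncomputable def diagGaussian (b : OrthonormalBasis (Fin d) ℝ (EuclideanSpace ℝ (Fin d)))
    (a : Fin d → ℝ) : Measure (EuclideanSpace ℝ (Fin d)) :=
  volume.withDensity fun h => ENNReal.ofReal
    (Real.exp (-(1 / 2) * diagForm b a h) / ∫ h, Real.exp (-(1 / 2) * diagForm b a h))

theorem isProbabilityMeasure_diagGaussian (ha : ∀ i, 0 < a i) :
    IsProbabilityMeasure (diagGaussian b a) := by
  have hZ := integral_exp_neg_diagForm_pos (b := b) ha
  refine ⟨?_⟩
  rw [diagGaussian, withDensity_apply _ MeasurableSet.univ, Measure.restrict_univ,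
    ← ofReal_integral_eq_lintegral_ofReal ((integrable_exp_neg_diagForm ha).div_const _)
      (ae_of_all _ fun h => by positivity), integral_div, div_self hZ.ne', ENNReal.ofReal_one]

theorem exp_neg_diagForm_div_integral (ha : ∀ i, 0 < a i) (h : EuclideanSpace ℝ (Fin d)) :
    Real.exp (-(1 / 2) * diagForm b a h) / (∫ h, Real.exp (-(1 / 2) * diagForm b a h))
      = ∏ i, gaussianPDFReal 0 ((a i)⁻¹).toNNReal (b.repr h i) := by
  rw [integral_exp_neg_diagForm, exp_neg_diagForm, ← Finset.prod_div_distrib]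
  refine Finset.prod_congr rfl fun i _ => ?_
  have := ha i
  rw [gaussianPDFReal, Real.coe_toNNReal _ (by positivity), div_eq_inv_mul, sub_zero]
  congr 2
  field_simp

/-- In the coordinates of b the integral splits into one-dimensional Gaussian characteristic
functions. This serves to identify the explicit density with `multivariateGaussian`. -/
theorem charFun_diagGaussian (ha : ∀ i, 0 < a i) (t : EuclideanSpace ℝ (Fin d)) :
    charFun (diagGaussian b a) t
      = Complex.exp (-((∑ i, (a i)⁻¹ * (b.repr t i) ^ 2 : ℝ) : ℂ) / 2) := by
  have hmeas : Measurable fun h => ENNReal.ofReal (Real.exp (-(1 / 2) * diagForm b a h)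
      / ∫ h, Real.exp (-(1 / 2) * diagForm b a h)) := by
    have := (continuous_diagForm (b := b) (a := a)).measurable
    fun_prop
  have hZ := integral_exp_neg_diagForm_pos (b := b) ha
  rw [charFun_apply, diagGaussian, integral_withDensity_eq_integral_toReal_smul hmeas
    (ae_of_all _ fun h => ENNReal.ofReal_lt_top)]
  have key : ∀ h, (ENNReal.ofReal (Real.exp (-(1 / 2) * diagForm b a h)
      / ∫ h, Real.exp (-(1 / 2) * diagForm b a h))).toReal
        • Complex.exp ((inner ℝ h t : ℝ) * Complex.I)
      = ∏ i, (gaussianPDFReal 0 ((a i)⁻¹).toNNReal (b.repr h i) •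
          Complex.exp ((b.repr t i : ℂ) * (b.repr h i : ℂ) * Complex.I)) := by
    intro h
    rw [ENNReal.toReal_ofReal (by positivity), exp_neg_diagForm_div_integral ha,
      ← b.repr.inner_map_map, PiLp.inner_apply]
    simp only [Complex.real_smul]
    rw [Finset.prod_mul_distrib, ← Complex.exp_sum, ← Finset.sum_mul]
    push_cast
    simp
  simp_rw [key]
  rw [b.integral_prod_coords (fun i x => gaussianPDFReal 0 ((a i)⁻¹).toNNReal x •
    Complex.exp ((b.repr t i : ℂ) * (x : ℂ) * Complex.I))]
  have h1 : ∀ i, ∫ x, gaussianPDFReal 0 ((a i)⁻¹).toNNReal x •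
      Complex.exp ((b.repr t i : ℂ) * (x : ℂ) * Complex.I)
      = Complex.exp (-((a i)⁻¹ * (b.repr t i) ^ 2 : ℝ) / 2) := by
    intro i
    have hv : ((a i)⁻¹).toNNReal ≠ 0 := by simpa using ha i
    rw [← integral_gaussianReal_eq_integral_smul hv, ← charFun_apply_real, charFun_gaussianReal]
    congr 1
    have : ((((a i)⁻¹).toNNReal : ℝ) : ℂ) = (((a i)⁻¹ : ℝ) : ℂ) := by
      rw [Real.coe_toNNReal _ (inv_pos.2 (ha i)).le]
    rw [this]
    push_cast
    ring
  rw [Finset.prod_congr rfl fun i _ => h1 i, ← Complex.exp_sum]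
  congr 1
  push_cast
  rw [← Finset.sum_div, Finset.sum_neg_distrib]

/-- A Gaussian measure whose covariance is diagonal in `b` is a dilation of a measure with
explicit Lebesgue density. -/
theorem multivariateGaussian_eq_map_diagGaussian (ha : ∀ i, 0 < a i)
    {S : Matrix (Fin d) (Fin d) ℝ} (hS : S.PosSemidef) (c : ℝ)
    (hq : ∀ x : EuclideanSpace ℝ (Fin d), x.ofLp ⬝ᵥ S.mulVec x.ofLp
      = ∑ i, c ^ 2 * (a i)⁻¹ * (b.repr x i) ^ 2) :
    multivariateGaussian 0 S = (diagGaussian b a).map (fun h => c • h) := by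
  have := isProbabilityMeasure_diagGaussian (b := b) ha
  have : IsProbabilityMeasure ((diagGaussian b a).map (fun h => c • h)) :=
    Measure.isProbabilityMeasure_map (by fun_prop)
  refine Measure.ext_of_charFun ?_
  ext t
  rw [charFun_multivariateGaussian hS, charFun_map_smul, charFun_diagGaussian ha, hq]
  congr 1
  simp only [inner_zero_right, Complex.ofReal_zero, zero_mul, zero_sub, neg_div, map_smul,
    PiLp.smul_apply, smul_eq_mul, mul_pow]
  congr 3
  exact Finset.sum_congr rfl fun i _ => by ring

end GaussianIntegrals

/-! ### Taylor estimates and strong concavity near the mode. -/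

section Taylor

variable {E : Type*} [NormedAddCommGroup E] [NormedSpace ℝ E]

set_option maxSynthPendingDepth 3

/-- Currying is a linear isometry, so differentiability can be moved from iterated derivatives to
nested ones; repeated use unpacks `Laplace.ThriceDifferentiable`. -/
theorem differentiableAt_iteratedFDeriv_fderiv {F : Type*} [NormedAddCommGroup F] [NormedSpace ℝ F]
    {f : E → F} {x : E} {k : ℕ} (h : DifferentiableAt ℝ (iteratedFDeriv ℝ (k + 1) f) x) :
    DifferentiableAt ℝ (iteratedFDeriv ℝ k (fderiv ℝ f)) x := by
  rw [funext fun x => iteratedFDeriv_succ_eq_comp_right (𝕜 := ℝ) (f := f) (x := x) (n := k)] at h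
  exact (LinearIsometryEquiv.comp_differentiableAt_iff _).1 h

theorem differentiableAt_of_iteratedFDeriv_zero {F : Type*} [NormedAddCommGroup F]
    [NormedSpace ℝ F] {f : E → F} {x : E} (h : DifferentiableAt ℝ (iteratedFDeriv ℝ 0 f) x) :
    DifferentiableAt ℝ f x := by
  rw [iteratedFDeriv_zero_eq_comp] at h
  exact (LinearIsometryEquiv.comp_differentiableAt_iff _).1 h

theorem norm_fderiv_fderiv_fderiv (L : E → ℝ) (x : E) :
    ‖fderiv ℝ (fderiv ℝ (fderiv ℝ L)) x‖ = ‖iteratedFDeriv ℝ 3 L x‖ := by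
  rw [← norm_iteratedFDeriv_fderiv, ← norm_iteratedFDeriv_fderiv, ← norm_iteratedFDeriv_fderiv,
    norm_iteratedFDeriv_zero]

/-- Second-order midpoint inequality for a function whose second derivative is at most `-c`. -/
theorem midpoint_le_of_second_deriv_le {φ φ' φ'' : ℝ → ℝ} {c : ℝ}
    (h1 : ∀ t ∈ Set.Icc (0 : ℝ) 1, HasDerivAt φ (φ' t) t)
    (h2 : ∀ t ∈ Set.Icc (0 : ℝ) 1, HasDerivAt φ' (φ'' t) t)
    (h3 : ∀ t ∈ Set.Icc (0 : ℝ) 1, φ'' t ≤ -c) :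
    (φ 0 + φ 1) / 2 + c / 8 ≤ φ (1 / 2) := by
  have hd1 : ∀ t ∈ Set.Icc (0 : ℝ) 1,
      HasDerivAt (fun t => φ t + c / 2 * t ^ 2) (φ' t + c * t) t := fun t ht => by
    refine ((h1 t ht).add ((hasDerivAt_pow 2 t).const_mul (c / 2))).congr_deriv ?_
    push_cast; ring
  have hd2 : ∀ t ∈ Set.Icc (0 : ℝ) 1,
      HasDerivAt (fun t => φ' t + c * t) (φ'' t + c) t := fun t ht => by
    refine ((h2 t ht).add ((hasDerivAt_id t).const_mul c)).congr_deriv ?_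
    ring
  -- Adding c t² / 2 still leaves a concave function; the endpoint average of that quadratic exceeds
  -- its midpoint value by c / 8.
  have hc : ConcaveOn ℝ (Set.Icc (0 : ℝ) 1) (fun t => φ t + c / 2 * t ^ 2) := by
    refine concaveOn_of_hasDerivWithinAt2_nonpos (convex_Icc 0 1)
      (f' := fun t => φ' t + c * t) (f'' := fun t => φ'' t + c)
      (fun t ht => (hd1 t ht).continuousAt.continuousWithinAt)
      (fun t ht => (hd1 t (interior_subset ht)).hasDerivWithinAt)
      (fun t ht => (hd2 t (interior_subset ht)).hasDerivWithinAt)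
      (fun t ht => by linarith [h3 t (interior_subset ht)])
  obtain ⟨-, hc⟩ := hc
  have := hc (Set.left_mem_Icc.2 zero_le_one) (Set.right_mem_Icc.2 zero_le_one)
    (show (0 : ℝ) ≤ 1 / 2 by norm_num) (show (0 : ℝ) ≤ 1 / 2 by norm_num) (by norm_num)
  norm_num at this
  norm_num
  linarith

variable {L : E → ℝ} {θ₀ : E} {δ C : ℝ}

theorem hasDerivAt_comp_segment {F : Type*} [NormedAddCommGroup F] [NormedSpace ℝ F] {f : E → F}
    {x w : E} {t : ℝ} (h : DifferentiableAt ℝ f (x + t • w)) :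
    HasDerivAt (fun t : ℝ => f (x + t • w)) (fderiv ℝ f (x + t • w) w) t := by
  have hl : HasDerivAt (fun t : ℝ => x + t • w) w t := by
    simpa using ((hasDerivAt_id t).smul_const w).const_add x
  exact h.hasFDerivAt.comp_hasDerivAt t hl

/-- The mean value inequality on the convex ball needs only a bounded, possibly discontinuous, third
derivative. -/
theorem norm_fderiv_fderiv_sub_le
    (hd : ∀ x ∈ Metric.closedBall θ₀ δ, DifferentiableAt ℝ (fderiv ℝ (fderiv ℝ L)) x)
    (hC : ∀ x ∈ Metric.closedBall θ₀ δ, ‖fderiv ℝ (fderiv ℝ (fderiv ℝ L)) x‖ ≤ C)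
    {x : E} (hx : x ∈ Metric.closedBall θ₀ δ) :
    ‖fderiv ℝ (fderiv ℝ L) x - fderiv ℝ (fderiv ℝ L) θ₀‖ ≤ C * ‖x - θ₀‖ := by
  have hδ : 0 ≤ δ := dist_nonneg.trans hx
  exact (convex_closedBall θ₀ δ).norm_image_sub_le_of_norm_fderiv_le hd hC
    (Metric.mem_closedBall_self hδ) hx

theorem add_smul_mem_closedBall {h : E} (hh : ‖h‖ ≤ δ) {t : ℝ} (ht : t ∈ Set.Icc (0 : ℝ) 1) :
    θ₀ + t • h ∈ Metric.closedBall θ₀ δ := by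
  rw [Metric.mem_closedBall, dist_eq_norm, add_sub_cancel_left, norm_smul, Real.norm_of_nonneg ht.1]
  have := mul_le_mul_of_nonneg_right ht.2 (norm_nonneg h)
  linarith

/-- First-order Taylor estimate for the gradient at a critical point. -/
theorem norm_fderiv_sub_le
    (hd1 : ∀ x ∈ Metric.closedBall θ₀ δ, DifferentiableAt ℝ (fderiv ℝ L) x)
    (hd : ∀ x ∈ Metric.closedBall θ₀ δ, DifferentiableAt ℝ (fderiv ℝ (fderiv ℝ L)) x)
    (hC : ∀ x ∈ Metric.closedBall θ₀ δ, ‖fderiv ℝ (fderiv ℝ (fderiv ℝ L)) x‖ ≤ C)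
    (hcrit : fderiv ℝ L θ₀ = 0) {h : E} (hh : ‖h‖ ≤ δ) {t : ℝ} (ht : t ∈ Set.Icc (0 : ℝ) 1) :
    ‖fderiv ℝ L (θ₀ + t • h) - t • fderiv ℝ (fderiv ℝ L) θ₀ h‖ ≤ C * ‖h‖ ^ 2 / 2 * t ^ 2 := by
  have hder : ∀ s ∈ Set.Icc (0 : ℝ) 1,
      HasDerivAt (fun s : ℝ => fderiv ℝ L (θ₀ + s • h) - s • fderiv ℝ (fderiv ℝ L) θ₀ h)
        (fderiv ℝ (fderiv ℝ L) (θ₀ + s • h) h - fderiv ℝ (fderiv ℝ L) θ₀ h) s := fun s hs => by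
    have h1 := hasDerivAt_comp_segment (hd1 _ (add_smul_mem_closedBall hh hs))
    have h2 := (hasDerivAt_id s).smul_const (fderiv ℝ (fderiv ℝ L) θ₀ h)
    rw [one_smul] at h2
    exact h1.sub h2
  refine image_norm_le_of_norm_deriv_right_le_deriv_boundary
    (f := fun s : ℝ => fderiv ℝ L (θ₀ + s • h) - s • fderiv ℝ (fderiv ℝ L) θ₀ h)
    (B := fun s => C * ‖h‖ ^ 2 / 2 * s ^ 2) (B' := fun s => C * ‖h‖ ^ 2 * s)
    (fun s hs => (hder s hs).continuousAt.continuousWithinAt)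
    (fun s hs => (hder s (Set.Ico_subset_Icc_self hs)).hasDerivWithinAt)
    (by simp [hcrit]) (fun s => ?_) (fun s hs => ?_) ht
  · refine ((hasDerivAt_pow 2 s).const_mul (C * ‖h‖ ^ 2 / 2)).congr_deriv ?_
    push_cast; ring
  · have h1 := norm_fderiv_fderiv_sub_le hd hC
      (add_smul_mem_closedBall (θ₀ := θ₀) hh (Set.Ico_subset_Icc_self hs))
    rw [add_sub_cancel_left, norm_smul, Real.norm_of_nonneg hs.1] at h1
    have h2 := (fderiv ℝ (fderiv ℝ L) (θ₀ + s • h) - fderiv ℝ (fderiv ℝ L) θ₀).le_opNorm h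
    rw [sub_apply] at h2
    refine h2.trans ((mul_le_mul_of_nonneg_right h1 (norm_nonneg _)).trans_eq ?_)
    ring

/-- Second-order Taylor estimate at a critical point. -/
theorem abs_sub_sub_le
    (hd0 : ∀ x ∈ Metric.closedBall θ₀ δ, DifferentiableAt ℝ L x)
    (hd1 : ∀ x ∈ Metric.closedBall θ₀ δ, DifferentiableAt ℝ (fderiv ℝ L) x)
    (hd : ∀ x ∈ Metric.closedBall θ₀ δ, DifferentiableAt ℝ (fderiv ℝ (fderiv ℝ L)) x)
    (hC : ∀ x ∈ Metric.closedBall θ₀ δ, ‖fderiv ℝ (fderiv ℝ (fderiv ℝ L)) x‖ ≤ C)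
    (hcrit : fderiv ℝ L θ₀ = 0) {h : E} (hh : ‖h‖ ≤ δ) :
    |L (θ₀ + h) - L θ₀ - fderiv ℝ (fderiv ℝ L) θ₀ h h / 2| ≤ C * ‖h‖ ^ 3 / 6 := by
  have hder : ∀ s ∈ Set.Icc (0 : ℝ) 1,
      HasDerivAt (fun s : ℝ => L (θ₀ + s • h) - L θ₀ - s ^ 2 * (fderiv ℝ (fderiv ℝ L) θ₀ h h / 2))
        (fderiv ℝ L (θ₀ + s • h) h - s * fderiv ℝ (fderiv ℝ L) θ₀ h h) s := fun s hs => by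
    have h1 := hasDerivAt_comp_segment (hd0 _ (add_smul_mem_closedBall hh hs))
    have h2 := (hasDerivAt_pow 2 s).mul_const (fderiv ℝ (fderiv ℝ L) θ₀ h h / 2)
    refine ((h1.sub_const (L θ₀)).sub h2).congr_deriv ?_
    push_cast; ring
  have := image_norm_le_of_norm_deriv_right_le_deriv_boundary
    (f := fun s : ℝ => L (θ₀ + s • h) - L θ₀ - s ^ 2 * (fderiv ℝ (fderiv ℝ L) θ₀ h h / 2))
    (B := fun s => C * ‖h‖ ^ 3 / 6 * s ^ 3) (B' := fun s => C * ‖h‖ ^ 3 / 2 * s ^ 2)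
    (fun s hs => (hder s hs).continuousAt.continuousWithinAt)
    (fun s hs => (hder s (Set.Ico_subset_Icc_self hs)).hasDerivWithinAt)
    (by simp) (fun s => ?_) (fun s hs => ?_) (Set.right_mem_Icc.2 zero_le_one)
  · simpa using this
  · refine ((hasDerivAt_pow 3 s).const_mul (C * ‖h‖ ^ 3 / 6)).congr_deriv ?_
    push_cast; ring
  · have h1 := norm_fderiv_sub_le hd1 hd hC hcrit hh (Set.Ico_subset_Icc_self hs)
    have h2 := (fderiv ℝ L (θ₀ + s • h) - s • fderiv ℝ (fderiv ℝ L) θ₀ h).le_opNorm h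
    rw [sub_apply, smul_apply, smul_eq_mul] at h2
    refine h2.trans ((mul_le_mul_of_nonneg_right h1 (norm_nonneg _)).trans_eq ?_)
    ring

/-- Strong concavity near a point where the Hessian is negative definite. -/
theorem midpoint_le_of_hessian_le
    (hd0 : ∀ x ∈ Metric.closedBall θ₀ δ, DifferentiableAt ℝ L x)
    (hd1 : ∀ x ∈ Metric.closedBall θ₀ δ, DifferentiableAt ℝ (fderiv ℝ L) x)
    (hd : ∀ x ∈ Metric.closedBall θ₀ δ, DifferentiableAt ℝ (fderiv ℝ (fderiv ℝ L)) x)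
    (hC : ∀ x ∈ Metric.closedBall θ₀ δ, ‖fderiv ℝ (fderiv ℝ (fderiv ℝ L)) x‖ ≤ C) {Λ : ℝ}
    (hΛ : ∀ w, fderiv ℝ (fderiv ℝ L) θ₀ w w ≤ -(Λ * ‖w‖ ^ 2)) {x y : E}
    (hx : x ∈ Metric.closedBall θ₀ δ) (hy : y ∈ Metric.closedBall θ₀ δ) :
    (L x + L y) / 2 + (Λ - C * δ) / 8 * ‖x - y‖ ^ 2 ≤ L ((1 / 2 : ℝ) • (x + y)) := by
  have hC0 : 0 ≤ C := (norm_nonneg _).trans (hC x hx)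
  have hmem : ∀ t ∈ Set.Icc (0 : ℝ) 1, x + t • (y - x) ∈ Metric.closedBall θ₀ δ := by
    intro t ht
    have := (convex_closedBall θ₀ δ).add_smul_sub_mem hx hy ht
    exact this
  have key := midpoint_le_of_second_deriv_le (φ := fun t => L (x + t • (y - x)))
    (φ' := fun t => fderiv ℝ L (x + t • (y - x)) (y - x))
    (φ'' := fun t => fderiv ℝ (fderiv ℝ L) (x + t • (y - x)) (y - x) (y - x))
    (c := (Λ - C * δ) * ‖x - y‖ ^ 2)
    (fun t ht => hasDerivAt_comp_segment (hd0 _ (hmem t ht)))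
    (fun t ht => by
      have h1 := hasDerivAt_comp_segment (hd1 _ (hmem t ht))
      simpa using h1.clm_apply (hasDerivAt_const t (y - x)))
    (fun t ht => by
      set z := x + t • (y - x)
      set w := y - x
      have h1 := norm_fderiv_fderiv_sub_le hd hC (hmem t ht)
      -- The Hessian at z differs from that at θ₀ by at most C δ in norm, so strong concavity with
      -- constant Λ - C δ survives along the whole segment.
      have h2 : C * ‖z - θ₀‖ ≤ C * δ := by
        gcongr
        rw [← dist_eq_norm]
        exact hmem t ht
      have h3 : ‖(fderiv ℝ (fderiv ℝ L) z - fderiv ℝ (fderiv ℝ L) θ₀) w w‖ ≤ C * δ * ‖w‖ * ‖w‖ := by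
        refine (ContinuousLinearMap.le_opNorm₂ _ w w).trans ?_
        gcongr
        exact h1.trans h2
      rw [sub_apply, sub_apply] at h3
      have h4 := (abs_le.1 h3).2
      have h5 := hΛ w
      rw [norm_sub_rev x y]
      change _ ≤ -((Λ - C * δ) * ‖w‖ ^ 2)
      nlinarith)
  have e1 : x + (1 / 2 : ℝ) • (y - x) = (1 / 2 : ℝ) • (x + y) := by module
  simp only [zero_smul, add_zero, one_smul, add_sub_cancel, e1] at key
  linarith

end Taylor

/-! ### Conditioning on a set, and Minkowski's inequality in L². -/

/-- Conditioning on a set changes probabilities by at most the mass of its complement. -/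
theorem abs_setIntegral_div_sub_le {α : Type*} [MeasurableSpace α] {μ : Measure α} {f : α → ℝ}
    (hf : Integrable f μ) (hf0 : ∀ x, 0 ≤ f x) {B S : Set α} (hB : MeasurableSet B)
    (hBpos : 0 < ∫ x in B, f x ∂μ) :
    |(∫ x in S, f x ∂μ) / (∫ x, f x ∂μ) - (∫ x in S ∩ B, f x ∂μ) / ∫ x in B, f x ∂μ|
      ≤ (∫ x in Bᶜ, f x ∂μ) / ∫ x, f x ∂μ := by
  have hsplit := integral_add_compl hB hf
  have hsplitS := integral_inter_add_sdiff (f := f) (s := S) hB hf.integrableOn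
  have h0 : 0 ≤ ∫ x in Bᶜ, f x ∂μ := integral_nonneg hf0
  have h1 : 0 ≤ ∫ x in S ∩ B, f x ∂μ := integral_nonneg hf0
  have h2 : 0 ≤ ∫ x in S \ B, f x ∂μ := integral_nonneg hf0
  have h3 : ∫ x in S \ B, f x ∂μ ≤ ∫ x in Bᶜ, f x ∂μ :=
    setIntegral_mono_set hf.integrableOn (ae_of_all _ hf0)
      (LE.le.eventuallyLE fun x hx => hx.2)
  have h4 : ∫ x in S ∩ B, f x ∂μ ≤ ∫ x in B, f x ∂μ :=
    setIntegral_mono_set hf.integrableOn (ae_of_all _ hf0)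
      (LE.le.eventuallyLE fun x hx => hx.2)
  rw [← hsplitS, ← hsplit]
  generalize ∫ x in Bᶜ, f x ∂μ = c at *
  generalize ∫ x in S ∩ B, f x ∂μ = s at *
  generalize ∫ x in S \ B, f x ∂μ = t at *
  generalize ∫ x in B, f x ∂μ = β at *
  have hZ : 0 < β + c := by linarith
  -- In the numerator both t and (s / β) c lie between 0 and c, so their difference is at most c in
  -- absolute value.
  have e : (s + t) / (β + c) - s / β = (t - s / β * c) / (β + c) := by
    field_simp
    ring
  have hsβ : s / β ≤ 1 := (div_le_one hBpos).2 h4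
  have hsβ0 : 0 ≤ s / β := by positivity
  rw [e, abs_div, abs_of_pos hZ]
  gcongr
  rw [abs_le]
  constructor <;> nlinarith [mul_nonneg hsβ0 h0]

/-- Minkowski's inequality in L²(γ) for X and a constant; Cauchy-Schwarz controls the cross term. It
lets the Taylor and prior contributions to the score add linearly in the final bound. -/
theorem integral_norm_sq_add_const_sq_le {α : Type*} [MeasurableSpace α] {μ : Measure α}
    {X γ : α → ℝ} (hγ0 : ∀ x, 0 ≤ γ x) (hγ : Integrable γ μ) (hXm : AEStronglyMeasurable X μ)
    (hX : Integrable (fun x => X x ^ 2 * γ x) μ) (hZ : 0 < ∫ x, γ x ∂μ) {m y : ℝ} (hm : 0 ≤ m)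
    (hy : 0 ≤ y) (hXy : ∫ x, X x ^ 2 * γ x ∂μ ≤ y ^ 2 * ∫ x, γ x ∂μ) :
    Integrable (fun x => (X x + m) ^ 2 * γ x) μ ∧
    ∫ x, (X x + m) ^ 2 * γ x ∂μ ≤ (y + m) ^ 2 * ∫ x, γ x ∂μ := by
  have hs : AEStronglyMeasurable (fun x => √(γ x)) μ :=
    Real.continuous_sqrt.comp_aestronglyMeasurable hγ.1
  have m1 : MemLp (fun x => X x * √(γ x)) 2 μ := by
    have hm' : AEStronglyMeasurable (fun x => X x * √(γ x)) μ := hXm.mul hs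
    rw [memLp_two_iff_integrable_sq hm']
    simpa only [mul_pow, Real.sq_sqrt (hγ0 _)] using hX
  have m2 : MemLp (fun x => √(γ x)) 2 μ := by
    rw [memLp_two_iff_integrable_sq hs]
    simpa only [Real.sq_sqrt (hγ0 _)] using hγ
  have hcs := sq_integral_mul_le m1 m2
  have i1 : Integrable (fun x => X x * γ x) μ := by
    have : Integrable (fun x => X x * √(γ x) * √(γ x)) μ := m1.integrable_mul m2
    simpa only [mul_assoc, Real.mul_self_sqrt (hγ0 _)] using this
  simp only [mul_pow, mul_assoc, Real.sq_sqrt (hγ0 _), Real.mul_self_sqrt (hγ0 _)] at hcs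
  have hlin : ∫ x, X x * γ x ∂μ ≤ y * ∫ x, γ x ∂μ := by
    refine le_of_sq_le_sq (hcs.trans ?_) (by positivity)
    rw [mul_pow, sq (∫ x, γ x ∂μ), ← mul_assoc]
    gcongr
  have i2 : Integrable (fun x => X x ^ 2 * γ x + 2 * m * (X x * γ x)) μ :=
    hX.add (i1.const_mul _)
  have e : (fun x => (X x + m) ^ 2 * γ x)
      = fun x => X x ^ 2 * γ x + 2 * m * (X x * γ x) + m ^ 2 * γ x := by
    ext x; ring
  rw [e]
  refine ⟨i2.add (hγ.const_mul _), ?_⟩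
  rw [integral_add i2 (hγ.const_mul _), integral_add hX (i1.const_mul _), integral_const_mul,
    integral_const_mul]
  nlinarith [mul_le_mul_of_nonneg_left hlin hm]

/-! ### The posterior inside and outside the ball about the mode. -/

section Core

set_option maxSynthPendingDepth 3

variable {d : ℕ} {b : OrthonormalBasis (Fin d) ℝ (EuclideanSpace ℝ (Fin d))} {a : Fin d → ℝ}
  {L prior : EuclideanSpace ℝ (Fin d) → ℝ} {θ₀ : EuclideanSpace ℝ (Fin d)}
  {δ C Λ : ℝ}

theorem setIntegral_closedBall_ge (ha : ∀ i, 0 < a i) {D : ℝ}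
    (hD : ∫ h in {h | δ < ‖h‖}, Real.exp (-(1 / 2) * diagForm b a h)
      ≤ D * ∫ h, Real.exp (-(1 / 2) * diagForm b a h)) :
    (1 - D) * ∫ h, Real.exp (-(1 / 2) * diagForm b a h)
      ≤ ∫ h in Metric.closedBall 0 δ, Real.exp (-(1 / 2) * diagForm b a h) := by
  have h := integral_add_compl (μ := volume)
    (Metric.isClosed_closedBall (x := (0 : EuclideanSpace ℝ (Fin d))) (ε := δ)).measurableSet
    (integrable_exp_neg_diagForm (b := b) ha)
  have e : (Metric.closedBall (0 : EuclideanSpace ℝ (Fin d)) δ)ᶜ = {h | δ < ‖h‖} := by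
    ext x
    simp
  rw [e] at h
  linarith

/-- Total variation bound between the posterior and the Gaussian, both conditioned on the ball of
radius `δ` about the mode. -/
theorem abs_setIntegral_posterior_ball_sub_le (ha : ∀ i, 0 < a i) (hδ : 0 < δ)
    (hd0 : ∀ x ∈ Metric.closedBall θ₀ δ, DifferentiableAt ℝ L x)
    (hd1 : ∀ x ∈ Metric.closedBall θ₀ δ, DifferentiableAt ℝ (fderiv ℝ L) x)
    (hd : ∀ x ∈ Metric.closedBall θ₀ δ, DifferentiableAt ℝ (fderiv ℝ (fderiv ℝ L)) x)
    (hC : ∀ x ∈ Metric.closedBall θ₀ δ, ‖fderiv ℝ (fderiv ℝ (fderiv ℝ L)) x‖ ≤ C)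
    (hcrit : fderiv ℝ L θ₀ = 0)
    (hform : ∀ h, fderiv ℝ (fderiv ℝ L) θ₀ h h = -diagForm b a h)
    (hΛ : ∀ w, fderiv ℝ (fderiv ℝ L) θ₀ w w ≤ -(Λ * ‖w‖ ^ 2)) (hΛC : C * δ < Λ)
    {D : ℝ} (hD1 : D < 1)
    (hD : ∫ h in {h | δ < ‖h‖}, Real.exp (-(1 / 2) * diagForm b a h)
      ≤ D * ∫ h, Real.exp (-(1 / 2) * diagForm b a h))
    {Mlow M₁ Mup : ℝ} (hMlow : 0 < Mlow) (hM₁ : 0 ≤ M₁)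
    (hlow : ∀ x ∈ Metric.closedBall θ₀ δ, Mlow⁻¹ ≤ prior x)
    (hup : ∀ x ∈ Metric.closedBall θ₀ δ, prior x ≤ Mup)
    (hpd : ∀ x ∈ Metric.closedBall θ₀ δ, DifferentiableAt ℝ prior x)
    (hgrad : ∀ x ∈ Metric.closedBall θ₀ δ, ‖(prior x)⁻¹ • fderiv ℝ prior x‖ ≤ M₁)
    {S : Set (EuclideanSpace ℝ (Fin d))} (hS : MeasurableSet S) :
    |(∫ h in S ∩ Metric.closedBall 0 δ, Real.exp (-(1 / 2) * diagForm b a h))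
        / (∫ h in Metric.closedBall 0 δ, Real.exp (-(1 / 2) * diagForm b a h))
      - (∫ h in S ∩ Metric.closedBall 0 δ, Real.exp (L (θ₀ + h)) * prior (θ₀ + h))
        / ∫ h in Metric.closedBall 0 δ, Real.exp (L (θ₀ + h)) * prior (θ₀ + h)|
      ≤ √(Mup * Mlow / (4 * (Λ - C * δ)))
        * (C / 2 * (√3 * (∑ i, (a i)⁻¹) / √(1 - D)) + M₁) := by
  have hmem : ∀ h ∈ Metric.closedBall (0 : EuclideanSpace ℝ (Fin d)) δ,
      θ₀ + h ∈ Metric.closedBall θ₀ δ := by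
    intro h hh
    simpa [dist_eq_norm] using hh
  have hC0 : 0 ≤ C := (norm_nonneg _).trans (hC θ₀ (Metric.mem_closedBall_self hδ.le))
  set H := fderiv ℝ (fderiv ℝ L) θ₀ with hH
  have hnhds : Metric.closedBall θ₀ δ ∈ 𝓝 θ₀ := Metric.closedBall_mem_nhds θ₀ hδ
  have hsymm : ∀ u w, H u w = H w u := by
    refine second_derivative_symmetric_of_eventually_of_real (f := L) (f' := fderiv ℝ L) (x := θ₀)
      ?_ (hd1 θ₀ (Metric.mem_closedBall_self hδ.le)).hasFDerivAt
    filter_upwards [hnhds] with y hy using (hd0 y hy).hasFDerivAt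
  -- By `hform` the function is half the Hessian form at the mode; symmetry of that form makes H h
  -- its derivative.
  have hv : ∀ h, HasFDerivAt (fun h => -(1 / 2) * diagForm b a h) (H h) h := by
    intro h
    have h1 : HasFDerivAt (fun h => H h h) (H h + H h) h := by
      refine (H.hasFDerivAt.clm_apply (hasFDerivAt_id h)).congr_fderiv ?_
      ext w
      simp [hsymm w h]
    have h2 := h1.const_mul (1 / 2)
    have h3 : (fun h => -(1 / 2) * diagForm b a h) = fun h => 1 / 2 * H h h := by
      ext h; rw [hform]; ring
    rw [h3]
    refine h2.congr_fderiv ?_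
    module
  have hL : ∀ h, fderiv ℝ (fun h => L (θ₀ + h)) h = fderiv ℝ L (θ₀ + h) := fun h =>
    fderiv_comp_add_left θ₀
  have hP : ∀ h, fderiv ℝ (fun h => prior (θ₀ + h)) h = fderiv ℝ prior (θ₀ + h) := fun h =>
    fderiv_comp_add_left θ₀
  -- The score difference is the first-order Taylor remainder of the gradient of L, minus the
  -- logarithmic gradient of the prior.
  have hN : ∀ h ∈ Metric.closedBall (0 : EuclideanSpace ℝ (Fin d)) δ,
      ‖fderiv ℝ (fun h => -(1 / 2) * diagForm b a h) h - fderiv ℝ (fun h => L (θ₀ + h)) h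
        - (prior (θ₀ + h))⁻¹ • fderiv ℝ (fun h => prior (θ₀ + h)) h‖
      ≤ C / 2 * ‖h‖ ^ 2 + M₁ := by
    intro h hh
    rw [(hv h).fderiv, hL, hP]
    refine (norm_sub_le _ _).trans (add_le_add ?_ (hgrad _ (hmem h hh)))
    have := norm_fderiv_sub_le hd1 hd hC hcrit (h := h) (by simpa using hh)
      (t := 1) (by simp)
    rw [one_smul, one_smul, norm_sub_rev] at this
    refine this.trans_eq ?_
    ring
  have hρ : 0 < Λ - C * δ := by linarith
  have hball : volume (Metric.closedBall (0 : EuclideanSpace ℝ (Fin d)) δ) ≠ 0 :=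
    (Metric.measure_closedBall_pos volume 0 hδ).ne'
  have key := sq_setIntegral_exp_div_sub_le (isCompact_closedBall 0 δ) (convex_closedBall 0 δ) hball
    (ℓ := fun h => L (θ₀ + h)) (v := fun h => -(1 / 2) * diagForm b a h)
    (p := fun h => prior (θ₀ + h)) (K := C / 2 * δ ^ 2 + M₁) hρ
    (fun x hx y hy => by
      have h1 := midpoint_le_of_hessian_le hd0 hd1 hd hC hΛ (hmem x hx) (hmem y hy)
      rw [add_sub_add_left_eq_sub] at h1
      have e : θ₀ + (1 / 2 : ℝ) • (x + y) = (1 / 2 : ℝ) • (θ₀ + x + (θ₀ + y)) := by module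
      rw [e]
      exact h1)
    (fun x hx => (hd0 _ (hmem x hx)).comp x (by fun_prop))
    (fun x _ => (hv x).differentiableAt)
    (fun x hx => (hpd _ (hmem x hx)).comp x (by fun_prop)) (inv_pos.2 hMlow)
    (fun x hx => hlow _ (hmem x hx)) (fun x hx => hup _ (hmem x hx))
    (fun x hx => (hN x hx).trans (by
      have : ‖x‖ ≤ δ := by simpa using hx
      gcongr)) hS
  have hBm : MeasurableSet (Metric.closedBall (0 : EuclideanSpace ℝ (Fin d)) δ) :=
    Metric.isClosed_closedBall.measurableSet
  set γ := fun h => Real.exp (-(1 / 2) * diagForm b a h) with hγ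
  have iγ := integrable_exp_neg_diagForm (b := b) ha
  have hZ := integral_exp_neg_diagForm_pos (b := b) ha
  have hZB := setIntegral_closedBall_ge ha hD
  have hZBpos : 0 < ∫ h in Metric.closedBall 0 δ, γ h :=
    lt_of_lt_of_le (mul_pos (by linarith) hZ) hZB
  set T := ∑ i, (a i)⁻¹ with hT
  have hT0 : 0 ≤ T := Finset.sum_nonneg fun i _ => (inv_pos.2 (ha i)).le
  have h1D : 0 < 1 - D := by linarith
  have i4 := (integrable_norm_pow_four_mul_exp_neg_diagForm (b := b) ha)
  have i4' : Integrable (fun h : EuclideanSpace ℝ (Fin d) => (C / 2 * ‖h‖ ^ 2) ^ 2 * γ h)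
      (volume.restrict (Metric.closedBall 0 δ)) := by
    refine ((i4.const_mul (C ^ 2 / 4)).integrableOn).congr_fun (fun h _ => ?_) hBm
    simp only [hγ]
    ring
  -- The fourth moment is extended to the whole space, where it is at most 3 T² times the full mass;
  -- returning to the mass of the ball costs the factor 1 / (1 - D).
  have h4 : ∫ h in Metric.closedBall 0 δ, (C / 2 * ‖h‖ ^ 2) ^ 2 * γ h
      ≤ (C / 2 * (√3 * T / √(1 - D))) ^ 2 * ∫ h in Metric.closedBall 0 δ, γ h := by
    calc ∫ h in Metric.closedBall 0 δ, (C / 2 * ‖h‖ ^ 2) ^ 2 * γ h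
        = C ^ 2 / 4 * ∫ h in Metric.closedBall 0 δ, ‖h‖ ^ 4 * γ h := by
          rw [← integral_const_mul]
          refine setIntegral_congr_fun hBm fun h _ => ?_
          ring
      _ ≤ C ^ 2 / 4 * (3 * T ^ 2 * ∫ h, γ h) := by
          refine mul_le_mul_of_nonneg_left ?_ (by positivity)
          refine le_trans ?_ (integral_norm_pow_four_mul_exp_neg_diagForm_le ha)
          exact setIntegral_le_integral i4 (ae_of_all _ fun h => by positivity)
      _ = (C / 2 * (√3 * T / √(1 - D))) ^ 2 * ((1 - D) * ∫ h, γ h) := by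
          rw [mul_pow, div_pow, div_pow, mul_pow, Real.sq_sqrt h1D.le, Real.sq_sqrt (by norm_num)]
          field_simp
          ring
      _ ≤ _ := by gcongr
  have hI := integral_norm_sq_add_const_sq_le (μ := volume.restrict (Metric.closedBall 0 δ))
    (fun h => (Real.exp_pos _).le) iγ.integrableOn
    (Continuous.aestronglyMeasurable (by fun_prop)) i4' hZBpos hM₁
    (by positivity) h4
  have hcmp : (∫ x in Metric.closedBall 0 δ,
      ‖fderiv ℝ (fun h => -(1 / 2) * diagForm b a h) x - fderiv ℝ (fun h => L (θ₀ + h)) x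
        - (prior (θ₀ + x))⁻¹ • fderiv ℝ (fun h => prior (θ₀ + h)) x‖ ^ 2 * γ x)
      ≤ ∫ h in Metric.closedBall 0 δ, (C / 2 * ‖h‖ ^ 2 + M₁) ^ 2 * γ h := by
    refine integral_mono_of_nonneg (ae_of_all _ fun h => by positivity) hI.1 ?_
    filter_upwards [ae_restrict_mem hBm] with h hh
    have := hN h hh
    gcongr
  have hMup : 0 < Mup := (inv_pos.2 hMlow).trans_le
    ((hlow θ₀ (Metric.mem_closedBall_self hδ.le)).trans
      (hup θ₀ (Metric.mem_closedBall_self hδ.le)))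
  refine abs_le_of_sq_le_sq (key.trans ?_) (by positivity)
  rw [mul_pow, Real.sq_sqrt (by positivity)]
  have e : Mup / (4 * (Λ - C * δ) * Mlow⁻¹) = Mup * Mlow / (4 * (Λ - C * δ)) := by
    field_simp
  rw [e]
  refine mul_le_mul_of_nonneg_left ?_ (by positivity)
  exact (div_le_iff₀ hZBpos).2 (hcmp.trans hI.2)

/-- The posterior mass outside the ball of radius `δ` about the mode. -/
theorem setIntegral_posterior_compl_le (ha : ∀ i, 0 < a i) (hδ : 0 < δ) {a' : Fin d → ℝ}
    (ha' : ∀ i, a' i = a i + C * δ / 3)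
    (hd0 : ∀ x ∈ Metric.closedBall θ₀ δ, DifferentiableAt ℝ L x)
    (hd1 : ∀ x ∈ Metric.closedBall θ₀ δ, DifferentiableAt ℝ (fderiv ℝ L) x)
    (hd : ∀ x ∈ Metric.closedBall θ₀ δ, DifferentiableAt ℝ (fderiv ℝ (fderiv ℝ L)) x)
    (hC : ∀ x ∈ Metric.closedBall θ₀ δ, ‖fderiv ℝ (fderiv ℝ (fderiv ℝ L)) x‖ ≤ C)
    (hcrit : fderiv ℝ L θ₀ = 0)
    (hform : ∀ h, fderiv ℝ (fderiv ℝ L) θ₀ h h = -diagForm b a h)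
    {D : ℝ} (hD1 : D < 1)
    (hD : ∫ h in {h | δ < ‖h‖}, Real.exp (-(1 / 2) * diagForm b a' h)
      ≤ D * ∫ h, Real.exp (-(1 / 2) * diagForm b a' h))
    {Mlow κ : ℝ} (hMlow : 0 < Mlow)
    (hlow : ∀ x ∈ Metric.closedBall θ₀ δ, Mlow⁻¹ ≤ prior x)
    (hprior0 : ∀ x, 0 ≤ prior x) (hprior : Integrable prior) (hprior1 : ∫ x, prior x = 1)
    (hq : Integrable fun h => Real.exp (L (θ₀ + h)) * prior (θ₀ + h))
    (hgap : ∀ x, δ < ‖x - θ₀‖ → L x - L θ₀ ≤ -κ) :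
    0 < (∫ h in Metric.closedBall 0 δ, Real.exp (L (θ₀ + h)) * prior (θ₀ + h)) ∧
    (∫ h in (Metric.closedBall 0 δ)ᶜ, Real.exp (L (θ₀ + h)) * prior (θ₀ + h))
      / (∫ h, Real.exp (L (θ₀ + h)) * prior (θ₀ + h))
      ≤ Real.exp (-κ) * Mlow / ((1 - D) * ∫ h, Real.exp (-(1 / 2) * diagForm b a' h)) := by
  have hC0 : 0 ≤ C := (norm_nonneg _).trans (hC θ₀ (Metric.mem_closedBall_self hδ.le))
  have hapos : ∀ i, 0 < a' i := fun i => by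
    rw [ha']; have := ha i; positivity
  have hBm : MeasurableSet (Metric.closedBall (0 : EuclideanSpace ℝ (Fin d)) δ) :=
    Metric.isClosed_closedBall.measurableSet
  have hZ := integral_exp_neg_diagForm_pos (b := b) hapos
  have hZB := setIntegral_closedBall_ge hapos hD
  set Z := ∫ h, Real.exp (-(1 / 2) * diagForm b a' h) with hZdef
  have h1D : 0 < 1 - D := by linarith
  have hlower : Real.exp (L θ₀) * Mlow⁻¹ * ((1 - D) * Z)
      ≤ ∫ h in Metric.closedBall 0 δ, Real.exp (L (θ₀ + h)) * prior (θ₀ + h) := by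
    calc Real.exp (L θ₀) * Mlow⁻¹ * ((1 - D) * Z)
        ≤ Real.exp (L θ₀) * Mlow⁻¹
          * ∫ h in Metric.closedBall 0 δ, Real.exp (-(1 / 2) * diagForm b a' h) := by gcongr
      _ = ∫ h in Metric.closedBall 0 δ,
          Real.exp (L θ₀) * Mlow⁻¹ * Real.exp (-(1 / 2) * diagForm b a' h) :=
          (integral_const_mul _ _).symm
      _ ≤ _ := by
        refine setIntegral_mono_on ((integrable_exp_neg_diagForm hapos).const_mul _).integrableOn
          hq.integrableOn hBm fun h hh => ?_
        have hh' : ‖h‖ ≤ δ := by simpa using hh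
        have hmem : θ₀ + h ∈ Metric.closedBall θ₀ δ := by simpa [dist_eq_norm] using hh
        have h1 := (abs_le.1 (abs_sub_sub_le hd0 hd1 hd hC hcrit hh')).1
        rw [hform] at h1
        -- Since ‖h‖ ≤ δ, the Taylor remainder C ‖h‖³ / 6 is at most half of (C δ / 3) ‖h‖², exactly
        -- what the shift from a to a' contributes.
        have h2 : diagForm b a' h = diagForm b a h + C * δ / 3 * ‖h‖ ^ 2 := by
          rw [diagForm, diagForm, b.norm_sq_eq_sum_coords, Finset.mul_sum,
            ← Finset.sum_add_distrib]
          exact Finset.sum_congr rfl fun i _ => by rw [ha']; ring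
        have h3 : C * ‖h‖ ^ 3 ≤ C * δ * ‖h‖ ^ 2 := by
          have : ‖h‖ ^ 3 ≤ δ * ‖h‖ ^ 2 := by
            rw [pow_succ, mul_comm]; gcongr
          nlinarith
        have h4 : Real.exp (L θ₀) * Real.exp (-(1 / 2) * diagForm b a' h)
            ≤ Real.exp (L (θ₀ + h)) := by
          rw [← Real.exp_add]
          refine Real.exp_le_exp.2 ?_
          rw [h2]
          linarith
        calc _ = Real.exp (L θ₀) * Real.exp (-(1 / 2) * diagForm b a' h) * Mlow⁻¹ := by ring
          _ ≤ _ := mul_le_mul h4 (hlow _ hmem) (inv_pos.2 hMlow).le (Real.exp_pos _).le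
  have hlowpos : 0 < Real.exp (L θ₀) * Mlow⁻¹ * ((1 - D) * Z) := by positivity
  have hBpos := hlowpos.trans_le hlower
  refine ⟨hBpos, ?_⟩
  have hq0 : ∀ h, 0 ≤ Real.exp (L (θ₀ + h)) * prior (θ₀ + h) := fun h =>
    mul_nonneg (Real.exp_pos _).le (hprior0 _)
  have htot : ∫ h in Metric.closedBall 0 δ, Real.exp (L (θ₀ + h)) * prior (θ₀ + h)
      ≤ ∫ h, Real.exp (L (θ₀ + h)) * prior (θ₀ + h) :=
    setIntegral_le_integral hq (ae_of_all _ hq0)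
  have hps : Integrable fun h => prior (θ₀ + h) := hprior.comp_add_left θ₀
  have hupper : ∫ h in (Metric.closedBall 0 δ)ᶜ, Real.exp (L (θ₀ + h)) * prior (θ₀ + h)
      ≤ Real.exp (L θ₀ - κ) := by
    calc ∫ h in (Metric.closedBall 0 δ)ᶜ, Real.exp (L (θ₀ + h)) * prior (θ₀ + h)
        ≤ ∫ h in (Metric.closedBall 0 δ)ᶜ, Real.exp (L θ₀ - κ) * prior (θ₀ + h) := by
          refine setIntegral_mono_on hq.integrableOn (hps.const_mul _).integrableOn hBm.compl
            fun h hh => ?_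
          have hh' : δ < ‖θ₀ + h - θ₀‖ := by simpa using hh
          have := hgap _ hh'
          exact mul_le_mul_of_nonneg_right (Real.exp_le_exp.2 (by linarith)) (hprior0 _)
      _ ≤ ∫ h, Real.exp (L θ₀ - κ) * prior (θ₀ + h) :=
          setIntegral_le_integral (hps.const_mul _)
            (ae_of_all _ fun h => mul_nonneg (Real.exp_pos _).le (hprior0 _))
      _ = Real.exp (L θ₀ - κ) := by
          rw [integral_const_mul, integral_add_left_eq_self (fun x => prior x), hprior1, mul_one]
  calc _ ≤ Real.exp (L θ₀ - κ) / (Real.exp (L θ₀) * Mlow⁻¹ * ((1 - D) * Z)) :=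
        div_le_div₀ (Real.exp_pos _).le hupper hlowpos (hlower.trans htot)
    _ = _ := by
        rw [sub_eq_add_neg, Real.exp_add]
        have := (Real.exp_pos (L θ₀)).ne'
        field_simp

end Core

/-! ### Trace, determinant and inverse read off an orthonormal eigenbasis. -/

section EigenBasis

variable {d : ℕ} {b : OrthonormalBasis (Fin d) ℝ (EuclideanSpace ℝ (Fin d))}
  {M : Matrix (Fin d) (Fin d) ℝ} {m : Fin d → ℝ}

theorem OrthonormalBasis.dotProduct_eq (b : OrthonormalBasis (Fin d) ℝ (EuclideanSpace ℝ (Fin d)))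
    (i j : Fin d) : (b i).ofLp ⬝ᵥ (b j).ofLp = if i = j then 1 else 0 := by
  have := orthonormal_iff_ite.1 b.orthonormal j i
  rw [EuclideanSpace.inner_eq_star_dotProduct] at this
  simpa [eq_comm] using this

/-- The columns of P are the basis vectors. Stating this for any eigenbasis, not the one attached to
M, lets one basis serve Ĵ, Ĵᵖ and their inverses at once. -/
theorem Matrix.exists_orthogonal_of_mulVec_eq
    (hM : ∀ i, M.mulVec (b i).ofLp = m i • (b i).ofLp) :
    ∃ P : Matrix (Fin d) (Fin d) ℝ, P.transpose * P = 1 ∧ P * P.transpose = 1 ∧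
      M = P * Matrix.diagonal m * P.transpose := by
  set P : Matrix (Fin d) (Fin d) ℝ := Matrix.of fun i j => (b j).ofLp i with hP
  have h1 : P.transpose * P = 1 := by
    ext i j
    rw [Matrix.mul_apply, Matrix.one_apply, ← b.dotProduct_eq i j]
    rfl
  have h2 : P * P.transpose = 1 := mul_eq_one_comm.1 h1
  have h3 : M * P = P * Matrix.diagonal m := by
    ext i j
    rw [Matrix.mul_diagonal]
    have := congrFun (hM j) i
    rw [Pi.smul_apply, smul_eq_mul, mul_comm] at this
    exact this
  refine ⟨P, h1, h2, ?_⟩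
  rw [← h3, Matrix.mul_assoc, h2, Matrix.mul_one]

theorem Matrix.trace_eq_sum_of_mulVec_eq
    (hM : ∀ i, M.mulVec (b i).ofLp = m i • (b i).ofLp) : M.trace = ∑ i, m i := by
  obtain ⟨P, h1, -, rfl⟩ := Matrix.exists_orthogonal_of_mulVec_eq hM
  rw [Matrix.trace_mul_comm, ← Matrix.mul_assoc, h1, Matrix.one_mul, Matrix.trace_diagonal]

theorem Matrix.det_eq_prod_of_mulVec_eq
    (hM : ∀ i, M.mulVec (b i).ofLp = m i • (b i).ofLp) : M.det = ∏ i, m i := by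
  obtain ⟨P, h1, -, rfl⟩ := Matrix.exists_orthogonal_of_mulVec_eq hM
  rw [Matrix.det_mul_comm, ← Matrix.mul_assoc, h1, Matrix.one_mul, Matrix.det_diagonal]

theorem Matrix.inv_mulVec_eq (hM : ∀ i, M.mulVec (b i).ofLp = m i • (b i).ofLp)
    (hm : ∀ i, m i ≠ 0) (i : Fin d) : M⁻¹.mulVec (b i).ofLp = (m i)⁻¹ • (b i).ofLp := by
  have hdet : IsUnit M.det := by
    rw [Matrix.det_eq_prod_of_mulVec_eq hM, isUnit_iff_ne_zero]
    exact Finset.prod_ne_zero_iff.2 fun i _ => hm i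
  have h := congrArg (M⁻¹.mulVec) (hM i)
  rw [Matrix.mulVec_mulVec, Matrix.nonsing_inv_mul _ hdet, Matrix.one_mulVec,
    Matrix.mulVec_smul] at h
  conv_rhs => rw [h, smul_smul, inv_mul_cancel₀ (hm i), one_smul]

theorem Matrix.dotProduct_mulVec_eq_sum (hM : ∀ i, M.mulVec (b i).ofLp = m i • (b i).ofLp)
    (x : EuclideanSpace ℝ (Fin d)) :
    x.ofLp ⬝ᵥ M.mulVec x.ofLp = ∑ i, m i * (b.repr x i) ^ 2 := by
  have hx : x.ofLp = ∑ i, b.repr x i • (b i).ofLp := by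
    conv_lhs => rw [← b.sum_repr x]
    simp
  have h1 : M.mulVec x.ofLp = ∑ i, (b.repr x i * m i) • (b i).ofLp := by
    conv_lhs => rw [hx]
    rw [Matrix.mulVec_sum]
    exact Finset.sum_congr rfl fun i _ => by rw [Matrix.mulVec_smul, hM, smul_smul]
  rw [h1, dotProduct_sum]
  refine Finset.sum_congr rfl fun i _ => ?_
  have h2 : x.ofLp ⬝ᵥ (b i).ofLp = b.repr x i := by
    rw [b.repr_apply_apply, EuclideanSpace.inner_eq_star_dotProduct]
    simp
  rw [dotProduct_smul, h2, smul_eq_mul]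
  ring

theorem Laplace.abs_le_opNorm (hM : ∀ i, M.mulVec (b i).ofLp = m i • (b i).ofLp) (i : Fin d) :
    |m i| ≤ Laplace.opNorm M := by
  have h := (Matrix.toEuclideanCLM (n := Fin d) (𝕜 := ℝ) M).le_opNorm (b i)
  have e : Matrix.toEuclideanCLM (n := Fin d) (𝕜 := ℝ) M (b i) = m i • b i := by
    apply (WithLp.ofLp_injective 2)
    rw [Matrix.ofLp_toEuclideanCLM, hM]
    rfl
  rw [e, norm_smul, b.norm_eq_one, mul_one, mul_one] at h
  exact h

end EigenBasis

/-! ### The matrices, laws and constants of the statement in coordinates. -/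

namespace Laplace

variable {d : ℕ} {n : ℕ} {L : EuclideanSpace ℝ (Fin d) → ℝ} {θ : EuclideanSpace ℝ (Fin d)}

theorem hessian_apply (i j : Fin d) :
    hessian L θ i j = fderiv ℝ (fderiv ℝ L) θ (EuclideanSpace.single i 1)
      (EuclideanSpace.single j 1) := by
  rw [hessian, Matrix.of_apply, iteratedFDeriv_two_apply]
  rfl

theorem dotProduct_hessian_mulVec (x : EuclideanSpace ℝ (Fin d)) :
    x.ofLp ⬝ᵥ (hessian L θ).mulVec x.ofLp = fderiv ℝ (fderiv ℝ L) θ x x := by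
  have hx : x = ∑ i, x i • EuclideanSpace.single i (1 : ℝ) := by
    conv_lhs => rw [← (EuclideanSpace.basisFun (Fin d) ℝ).sum_repr x]
    simp
  conv_rhs => rw [hx]
  simp only [dotProduct, Matrix.mulVec, map_sum, map_smul, sum_apply, smul_apply, hessian_apply,
    Finset.mul_sum, smul_eq_mul]
  rw [Finset.sum_comm]
  refine Finset.sum_congr rfl fun i _ => Finset.sum_congr rfl fun j _ => ?_
  ring

theorem dotProduct_Jhat_mulVec (hn : 1 ≤ n) (x : EuclideanSpace ℝ (Fin d)) :
    fderiv ℝ (fderiv ℝ L) θ x x = -(n * (x.ofLp ⬝ᵥ (Jhat n L θ).mulVec x.ofLp)) := by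
  have : (n : ℝ) ≠ 0 := by positivity
  rw [Jhat, Matrix.neg_mulVec, Matrix.smul_mulVec, dotProduct_neg, dotProduct_smul,
    dotProduct_hessian_mulVec, smul_eq_mul]
  field_simp

theorem isHermitian_Jhat (hsymm : ∀ u w, fderiv ℝ (fderiv ℝ L) θ u w
    = fderiv ℝ (fderiv ℝ L) θ w u) : (Jhat n L θ).IsHermitian := by
  refine Matrix.IsHermitian.ext fun i j => ?_
  simp [Jhat, hessian_apply, hsymm (EuclideanSpace.single i 1)]

theorem lamMin_le_eigenvalues {A : Matrix (Fin d) (Fin d) ℝ} (hA : A.IsHermitian) (i : Fin d) :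
    lamMin A ≤ hA.eigenvalues i := by
  rw [lamMin, hA.spectrum_real_eq_range_eigenvalues]
  exact csInf_le (Set.finite_range _).bddBelow (Set.mem_range_self i)

theorem JhatP_mulVec {δ M₂ : ℝ} {v : Fin d → ℝ} {l : ℝ} (h : (Jhat n L θ).mulVec v = l • v) :
    (JhatP n L θ δ M₂).mulVec v = (l + δ * M₂ / 3) • v := by
  rw [JhatP, Matrix.add_mulVec, h, Matrix.smul_mulVec, Matrix.one_mulVec, add_smul]

theorem measureReal_withDensity_div {α : Type*} [MeasurableSpace α] {μ : Measure α} {f : α → ℝ}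
    (hf : Integrable f μ) (hf0 : ∀ x, 0 ≤ f x) {S : Set α} (hS : MeasurableSet S) {z : ℝ}
    (hz : 0 ≤ z) :
    (μ.withDensity fun x => ENNReal.ofReal (f x / z)).real S = (∫ x in S, f x ∂μ) / z := by
  rw [measureReal_def, withDensity_apply _ hS, ← ofReal_integral_eq_lintegral_ofReal
    (hf.div_const z).integrableOn (ae_of_all _ fun x => div_nonneg (hf0 x) hz),
    integral_div, ENNReal.toReal_ofReal (div_nonneg (integral_nonneg hf0) hz)]

theorem rescaledPosterior_real {prior : EuclideanSpace ℝ (Fin d) → ℝ}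
    (hq : Integrable fun θ => Real.exp (L θ) * prior θ) (hprior : ∀ θ, 0 ≤ prior θ)
    {A : Set (EuclideanSpace ℝ (Fin d))} (hA : MeasurableSet A) :
    (rescaledPosterior n L prior θ).real A
      = (∫ h in (fun h => √(n : ℝ) • h) ⁻¹' A, Real.exp (L (θ + h)) * prior (θ + h))
        / ∫ h, Real.exp (L (θ + h)) * prior (θ + h) := by
  have hm : Measurable fun t => √(n : ℝ) • (t - θ) := by fun_prop
  have hq0 : ∀ t, 0 ≤ Real.exp (L t) * prior t := fun t => mul_nonneg (Real.exp_pos _).le (hprior t)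
  rw [rescaledPosterior, map_measureReal_apply hm hA, posterior,
    measureReal_withDensity_div hq hq0 (hm hA) (integral_nonneg hq0)]
  have ht := integral_add_left_eq_self (μ := volume) (fun x => Real.exp (L x) * prior x) θ
  rw [ht]
  congr 1
  have h := (measurePreserving_add_left (volume : Measure (EuclideanSpace ℝ (Fin d)))
    θ).setIntegral_preimage_emb (measurableEmbedding_addLeft θ) (fun x => Real.exp (L x) * prior x)
    ((fun t => √(n : ℝ) • (t - θ)) ⁻¹' A)
  rw [← h]
  congr 2
  ext h
  simp

theorem map_diagGaussian_real {b : OrthonormalBasis (Fin d) ℝ (EuclideanSpace ℝ (Fin d))}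
    {a : Fin d → ℝ} (ha : ∀ i, 0 < a i) (c : ℝ) {A : Set (EuclideanSpace ℝ (Fin d))}
    (hA : MeasurableSet A) :
    ((diagGaussian b a).map fun h => c • h).real A
      = (∫ h in (fun h => c • h) ⁻¹' A, Real.exp (-(1 / 2) * diagForm b a h))
        / ∫ h, Real.exp (-(1 / 2) * diagForm b a h) := by
  have hm : Measurable fun h : EuclideanSpace ℝ (Fin d) => c • h := by fun_prop
  rw [map_measureReal_apply hm hA, diagGaussian,
    measureReal_withDensity_div (integrable_exp_neg_diagForm ha) (fun h => (Real.exp_pos _).le)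
      (hm hA) (integral_exp_neg_diagForm_pos ha).le]

end Laplace

namespace Laplace

/-- Translates the Gaussian tail exponent from the unscaled variable h, with precision n l, to the
√n-scaled form used in `Laplace.Dhat` and `Laplace.DhatP`. -/
theorem neg_half_mul_sq_sqrt_sub {n δ t l : ℝ} (hn : 0 < n) :
    -(1 / 2) * (δ - √(t / n)) ^ 2 * (n * l) = -(1 / 2) * (δ * √n - √t) ^ 2 * l := by
  have h : √n ^ 2 = n := Real.sq_sqrt hn.le
  have hs : √n ≠ 0 := (Real.sqrt_pos.2 hn).ne'
  have e : δ * √n - √t = (δ - √(t / n)) * √n := by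
    rw [Real.sqrt_div' t hn.le]
    field_simp
  rw [e, mul_pow, h]
  ring

theorem prod_sqrt_two_pi_div {d : ℕ} {n : ℝ} (hn : 0 < n) {l : Fin d → ℝ} (hl : ∀ i, 0 < l i) :
    ∏ i, √(2 * Real.pi / (n * l i))
      = (2 * Real.pi) ^ ((d : ℝ) / 2) / (n ^ ((d : ℝ) / 2) * √(∏ i, l i)) := by
  have hs : ∀ x : ℝ, 0 < x → √x ^ d = x ^ ((d : ℝ) / 2) := by
    intro x hx
    rw [Real.sqrt_eq_rpow, ← Real.rpow_natCast, ← Real.rpow_mul hx.le]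
    congr 1
    ring
  have hprod : √(∏ i, l i) = ∏ i, √(l i) := Real.sqrt_prod _ fun i _ => (hl i).le
  rw [hprod, ← hs _ (by positivity), ← hs _ hn]
  have : ∀ i, √(2 * Real.pi / (n * l i)) = √(2 * Real.pi) / (√n * √(l i)) := fun i => by
    rw [Real.sqrt_div (by positivity), Real.sqrt_mul hn.le]
  rw [Finset.prod_congr rfl fun i _ => this i, Finset.prod_div_distrib, Finset.prod_mul_distrib]
  simp

/-- The scalar form in which the bound on the ball appears in the theorem. -/
theorem ball_bound_eq {n R T M M₁ M₂ D : ℝ} (hn : 0 < n) (hR : 0 < R) (hD : 0 < 1 - D) :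
    √(M / (4 * (n * R))) * (n * M₂ / 2 * (√3 * (T / n) / √(1 - D)) + M₁)
      = √3 * T * √M * M₂ / (4 * √(n * R * (1 - D))) + M₁ * √M / (2 * √(n * R)) := by
  have h4 : √(4 * (n * R)) = 2 * √(n * R) := by
    rw [Real.sqrt_mul (by norm_num), show (4 : ℝ) = 2 ^ 2 by norm_num,
      Real.sqrt_sq (by norm_num)]
  have h1 : √(n * R) ≠ 0 := (Real.sqrt_pos.2 (by positivity)).ne'
  have h2 : √(1 - D) ≠ 0 := (Real.sqrt_pos.2 hD).ne'
  rw [Real.sqrt_div' _ (by positivity), h4, Real.sqrt_mul (by positivity) (1 - D)]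
  field_simp
  ring

end Laplace

end

/-! ### Assembly of the total variation bound. -/

set_option maxSynthPendingDepth 3 in
theorem mainTheorem4 (d n : ℕ) (hd : 1 ≤ d) (hn : 1 ≤ n)
    -- the generalized log-likelihood, the prior density, the generalized posterior density
    (L prior : EuclideanSpace ℝ (Fin d) → ℝ)
    (hprior_nonneg : ∀ θ, 0 ≤ prior θ)
    (hprior_int : Integrable prior)
    (hprior_one : ∫ θ, prior θ = 1)
    (hpost_meas : AEMeasurable (fun θ => Real.exp (L θ) * prior θ))
    -- the unique MLE, and the bound on the third derivative near it
    (θhat : EuclideanSpace ℝ (Fin d)) (hMLE : Laplace.IsMLE L θhat)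
    (δ M₂ : ℝ) (hδ : 0 < δ) (hM₂ : 0 < M₂)
    (hL_diff : Laplace.ThriceDifferentiable L (Metric.closedBall θhat δ))
    (hL_third : ∀ θ, ‖θ - θhat‖ ≤ δ → ‖iteratedFDeriv ℝ 3 L θ‖ / n ≤ M₂)
    -- lower bound on the prior near the MLE
    (Mhat₁ : ℝ) (hMhat₁ : 0 < Mhat₁)
    (hprior_lower : ∀ θ, ‖θ - θhat‖ ≤ δ → 0 < prior θ ∧ |1 / prior θ| ≤ Mhat₁)
    -- size of δ
    (hδ_size : Real.sqrt ((Laplace.Jhat n L θhat)⁻¹.trace / n) < δ)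
    -- minimal eigenvalue
    (hlam : δ * M₂ < Laplace.lamMin (Laplace.Jhat n L θhat))
    -- gap of the log-likelihood away from the MLE
    (κ : ℝ) (hκ : 0 < κ)
    (hgap : ∀ θ, δ < ‖θ - θhat‖ → (L θ - L θhat) / n ≤ -κ)
    -- upper bounds on the prior and on its logarithmic gradient near the MLE
    (M₁ Mtilde₁ : ℝ) (hM₁ : 0 < M₁) (hMtilde₁ : 0 < Mtilde₁)
    (hprior_diff : ∀ θ, ‖θ - θhat‖ ≤ δ → DifferentiableAt ℝ prior θ)
    (hprior_grad : ∀ θ, ‖θ - θhat‖ ≤ δ → ‖(prior θ)⁻¹ • gradient prior θ‖ ≤ M₁)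
    (hprior_upper : ∀ θ, ‖θ - θhat‖ ≤ δ → |prior θ| ≤ Mtilde₁) :
    Laplace.tvDist (Laplace.rescaledPosterior n L prior θhat)
        (multivariateGaussian 0 (Laplace.Jhat n L θhat)⁻¹) ≤
      Real.sqrt 3 * (Laplace.Jhat n L θhat)⁻¹.trace * Real.sqrt (Mtilde₁ * Mhat₁) * M₂ /
          (4 * Real.sqrt (n * (Laplace.lamMin (Laplace.Jhat n L θhat) - δ * M₂)
            * (1 - Laplace.Dhat n L θhat δ)))
        + M₁ * Real.sqrt (Mtilde₁ * Mhat₁) /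
          (2 * Real.sqrt (n * (Laplace.lamMin (Laplace.Jhat n L θhat) - δ * M₂)))
        + 2 * Laplace.Dhat n L θhat δ
        + 2 * (n : ℝ) ^ ((d : ℝ) / 2) * Real.exp (-(n * κ)) * Mhat₁
            * Real.sqrt |(Laplace.JhatP n L θhat δ M₂).det| /
          ((2 * Real.pi) ^ ((d : ℝ) / 2) * (1 - Laplace.DhatP n L θhat δ M₂)) := by
  have hn0 : (0 : ℝ) < n := by exact_mod_cast hn
  -- differentiability of the log-likelihood
  have hball : ∀ θ, θ ∈ Metric.closedBall θhat δ → ‖θ - θhat‖ ≤ δ := fun θ hθ => by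
    rw [← dist_eq_norm]; exact hθ
  have hself : θhat ∈ Metric.closedBall θhat δ := Metric.mem_closedBall_self hδ.le
  have hd0 : ∀ x ∈ Metric.closedBall θhat δ, DifferentiableAt ℝ L x := fun x hx =>
    differentiableAt_of_iteratedFDeriv_zero (hL_diff x hx 0 (by norm_num))
  have hd1 : ∀ x ∈ Metric.closedBall θhat δ, DifferentiableAt ℝ (fderiv ℝ L) x := fun x hx =>
    differentiableAt_of_iteratedFDeriv_zero
      (differentiableAt_iteratedFDeriv_fderiv (hL_diff x hx 1 (by norm_num)))
  have hd2 : ∀ x ∈ Metric.closedBall θhat δ, DifferentiableAt ℝ (fderiv ℝ (fderiv ℝ L)) x :=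
    fun x hx => differentiableAt_of_iteratedFDeriv_zero (differentiableAt_iteratedFDeriv_fderiv
      (differentiableAt_iteratedFDeriv_fderiv (hL_diff x hx 2 (by norm_num))))
  have hC : ∀ x ∈ Metric.closedBall θhat δ, ‖fderiv ℝ (fderiv ℝ (fderiv ℝ L)) x‖ ≤ n * M₂ := by
    intro x hx
    rw [norm_fderiv_fderiv_fderiv]
    have := (div_le_iff₀ hn0).1 (hL_third x (hball x hx))
    linarith
  have hcrit : fderiv ℝ L θhat = 0 :=
    IsLocalMax.fderiv_eq_zero (Filter.Eventually.of_forall hMLE.1)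
  have hsymm : ∀ u w, fderiv ℝ (fderiv ℝ L) θhat u w = fderiv ℝ (fderiv ℝ L) θhat w u := by
    refine second_derivative_symmetric_of_eventually_of_real (f := L) (f' := fderiv ℝ L) (x := θhat)
      ?_ (hd1 θhat hself).hasFDerivAt
    filter_upwards [Metric.closedBall_mem_nhds θhat hδ] with y hy using (hd0 y hy).hasFDerivAt
  -- diagonalization
  have hJ : (Laplace.Jhat n L θhat).IsHermitian := Laplace.isHermitian_Jhat hsymm
  set J := Laplace.Jhat n L θhat with hJdef
  set JP := Laplace.JhatP n L θhat δ M₂ with hJPdef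
  set lm := Laplace.lamMin J with hlm
  have hlm0 : 0 < lm := (mul_pos hδ hM₂).trans hlam
  set b := hJ.eigenvectorBasis with hb
  set l := hJ.eigenvalues with hl
  have hlle : ∀ i, lm ≤ l i := Laplace.lamMin_le_eigenvalues hJ
  have hl0 : ∀ i, 0 < l i := fun i => hlm0.trans_le (hlle i)
  have hJb : ∀ i, J.mulVec (b i).ofLp = l i • (b i).ofLp := hJ.mulVec_eigenvectorBasis
  have hJPb : ∀ i, JP.mulVec (b i).ofLp = (l i + δ * M₂ / 3) • (b i).ofLp := fun i =>
    Laplace.JhatP_mulVec (hJb i)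
  have hp0 : 0 < δ * M₂ / 3 := by positivity
  have hlP0 : ∀ i, 0 < l i + δ * M₂ / 3 := fun i => by have := hl0 i; linarith
  have hJinv := Matrix.inv_mulVec_eq hJb fun i => (hl0 i).ne'
  have hJPinv := Matrix.inv_mulVec_eq hJPb fun i => (hlP0 i).ne'
  have htr : J⁻¹.trace = ∑ i, (l i)⁻¹ := Matrix.trace_eq_sum_of_mulVec_eq hJinv
  have htrP : JP⁻¹.trace = ∑ i, (l i + δ * M₂ / 3)⁻¹ := Matrix.trace_eq_sum_of_mulVec_eq hJPinv
  have hdetP : JP.det = ∏ i, (l i + δ * M₂ / 3) := Matrix.det_eq_prod_of_mulVec_eq hJPb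
  -- The tail estimate asks only for an upper bound on the inverse eigenvalues, so this one
  -- inequality replaces a computation of the spectral norm.
  have hop : ∀ i, (l i + δ * M₂ / 3)⁻¹ ≤ Laplace.opNorm JP⁻¹ := fun i =>
    (le_abs_self _).trans (Laplace.abs_le_opNorm hJPinv i)
  have hop0 : 0 < Laplace.opNorm JP⁻¹ :=
    (inv_pos.2 (hlP0 ⟨0, hd⟩)).trans_le (hop ⟨0, hd⟩)
  -- Precisions in the unscaled variable h, hence the factor n; the dilation by √n enters only
  -- through the preimage of the test set.
  set a : Fin d → ℝ := fun i => n * l i with ha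
  set a' : Fin d → ℝ := fun i => n * (l i + δ * M₂ / 3) with ha'
  have ha0 : ∀ i, 0 < a i := fun i => mul_pos hn0 (hl0 i)
  have ha'0 : ∀ i, 0 < a' i := fun i => mul_pos hn0 (hlP0 i)
  have hsum : ∑ i, (a i)⁻¹ = J⁻¹.trace / n := by
    rw [htr, Finset.sum_div]
    exact Finset.sum_congr rfl fun i _ => by
      simp only [ha]
      rw [mul_inv, mul_comm, ← div_eq_mul_inv]
  have hsum' : ∑ i, (a' i)⁻¹ = JP⁻¹.trace / n := by
    rw [htrP, Finset.sum_div]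
    exact Finset.sum_congr rfl fun i _ => by
      simp only [ha']
      rw [mul_inv, mul_comm, ← div_eq_mul_inv]
  have hform : ∀ h, fderiv ℝ (fderiv ℝ L) θhat h h = -diagForm b a h := by
    intro h
    rw [Laplace.dotProduct_Jhat_mulVec hn, ← hJdef, Matrix.dotProduct_mulVec_eq_sum hJb, diagForm,
      Finset.mul_sum]
    simp only [ha, mul_assoc]
  have hΛ : ∀ w, fderiv ℝ (fderiv ℝ L) θhat w w ≤ -(n * lm * ‖w‖ ^ 2) := by
    intro w
    rw [hform, neg_le_neg_iff, b.norm_sq_eq_sum_coords, Finset.mul_sum, diagForm]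
    refine Finset.sum_le_sum fun i _ => ?_
    simp only [ha]
    have := hlle i
    gcongr
  -- Gaussian tails
  have hδ' : √(∑ i, (a i)⁻¹) < δ := by rwa [hsum]
  -- The positive shift only enlarges the precisions, so the size condition on δ passes from Ĵ to
  -- Ĵᵖ.
  have hδP : √(∑ i, (a' i)⁻¹) < δ := by
    refine lt_of_le_of_lt (Real.sqrt_le_sqrt ?_) hδ'
    refine Finset.sum_le_sum fun i _ => inv_anti₀ (ha0 i) ?_
    simp only [ha, ha']
    gcongr
    linarith
  have hD := setIntegral_exp_neg_diagForm_le (b := b) ha0 (σ := (n * lm)⁻¹) (by positivity)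
    (fun i => inv_anti₀ (by positivity) (by simp only [ha]; gcongr; exact hlle i)) hδ'
  have hDP := setIntegral_exp_neg_diagForm_le (b := b) ha'0 (σ := Laplace.opNorm JP⁻¹ / n)
    (by positivity) (fun i => by
      simp only [ha']
      rw [mul_inv, mul_comm, ← div_eq_mul_inv]
      gcongr
      exact hop i) hδP
  have hDeq : Real.exp (-(1 / 2) * (δ - √(∑ i, (a i)⁻¹)) ^ 2 * ((n * lm)⁻¹)⁻¹)
      = Laplace.Dhat n L θhat δ := by
    rw [inv_inv, hsum, Laplace.neg_half_mul_sq_sqrt_sub hn0]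
    rfl
  have hDPeq : Real.exp (-(1 / 2) * (δ - √(∑ i, (a' i)⁻¹)) ^ 2 * (Laplace.opNorm JP⁻¹ / n)⁻¹)
      = Laplace.DhatP n L θhat δ M₂ := by
    rw [inv_div, hsum', div_eq_mul_inv (n : ℝ), Laplace.neg_half_mul_sq_sqrt_sub hn0]
    rfl
  have hD1 : Laplace.Dhat n L θhat δ < 1 := by
    rw [← hDeq, Real.exp_lt_one_iff, neg_mul, neg_mul, neg_lt_zero]
    have := sub_pos.2 hδ'
    positivity
  have hDP1 : Laplace.DhatP n L θhat δ M₂ < 1 := by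
    rw [← hDPeq, Real.exp_lt_one_iff, neg_mul, neg_mul, neg_lt_zero]
    have := sub_pos.2 hδP
    positivity
  rw [hDeq] at hD
  rw [hDPeq] at hDP
  set D := Laplace.Dhat n L θhat δ with hDdef
  set DP := Laplace.DhatP n L θhat δ M₂ with hDPdef
  have hD0 : 0 ≤ D := (Real.exp_pos _).le
  have h1D : 0 < 1 - D := by linarith
  have h1DP : 0 < 1 - DP := by linarith
  -- the posterior density
  have hq : Integrable fun θ => Real.exp (L θ) * prior θ := by
    refine (hprior_int.const_mul (Real.exp (L θhat))).mono' hpost_meas.aestronglyMeasurable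
      (ae_of_all _ fun θ => ?_)
    rw [Real.norm_of_nonneg (mul_nonneg (Real.exp_pos _).le (hprior_nonneg θ))]
    exact mul_le_mul_of_nonneg_right (Real.exp_le_exp.2 (hMLE.1 θ)) (hprior_nonneg θ)
  have hqs : Integrable fun h => Real.exp (L (θhat + h)) * prior (θhat + h) :=
    hq.comp_add_left θhat
  have hlow : ∀ x ∈ Metric.closedBall θhat δ, Mhat₁⁻¹ ≤ prior x := by
    intro x hx
    obtain ⟨h1, h2⟩ := hprior_lower x (hball x hx)
    rw [abs_of_pos (by positivity), one_div] at h2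
    exact inv_le_of_inv_le₀ h1 h2
  have hgrad : ∀ x ∈ Metric.closedBall θhat δ, ‖(prior x)⁻¹ • fderiv ℝ prior x‖ ≤ M₁ := by
    intro x hx
    have := hprior_grad x (hball x hx)
    rw [norm_smul, gradient, LinearIsometryEquiv.norm_map] at this
    rwa [norm_smul]
  have htail := setIntegral_posterior_compl_le ha0 hδ (a' := a') (C := n * M₂) (κ := n * κ)
    (fun i => by simp only [ha, ha']; ring) hd0 hd1 hd2 hC hcrit hform hDP1 hDP hMhat₁ hlow
    hprior_nonneg hprior_int hprior_one hqs (fun x hx => by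
      have := (div_le_iff₀ hn0).1 (hgap x hx)
      linarith)
  -- comparison on each measurable set
  have hG : multivariateGaussian 0 J⁻¹ = (diagGaussian b a).map fun h => √(n : ℝ) • h := by
    refine multivariateGaussian_eq_map_diagGaussian ha0 ?_ _ fun x => ?_
    · exact (hJ.posDef_iff_eigenvalues_pos.2 hl0).inv.posSemidef
    · rw [Matrix.dotProduct_mulVec_eq_sum hJinv, Real.sq_sqrt hn0.le]
      refine Finset.sum_congr rfl fun i _ => ?_
      simp only [ha]
      field_simp
  have hZP : ∫ h, Real.exp (-(1 / 2) * diagForm b a' h)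
      = (2 * Real.pi) ^ ((d : ℝ) / 2) / ((n : ℝ) ^ ((d : ℝ) / 2) * √|JP.det|) := by
    rw [integral_exp_neg_diagForm, Laplace.prod_sqrt_two_pi_div hn0 hlP0, hdetP,
      abs_of_pos (Finset.prod_pos fun i _ => hlP0 i)]
  have hdet0 : 0 < √|JP.det| := by
    rw [hdetP]
    exact Real.sqrt_pos.2 (abs_pos.2 (Finset.prod_pos fun i _ => hlP0 i).ne')
  have hBm : MeasurableSet (Metric.closedBall (0 : EuclideanSpace ℝ (Fin d)) δ) :=
    Metric.isClosed_closedBall.measurableSet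
  refine ciSup_le fun ⟨A, hA⟩ => ?_
  simp only
  rw [Laplace.rescaledPosterior_real hq hprior_nonneg hA, hG, Laplace.map_diagGaussian_real ha0 _ hA]
  set S := (fun h : EuclideanSpace ℝ (Fin d) => √(n : ℝ) • h) ⁻¹' A with hS
  have hSm : MeasurableSet S :=
    (show Measurable fun h : EuclideanSpace ℝ (Fin d) => √(n : ℝ) • h by fun_prop) hA
  have hmid := abs_setIntegral_posterior_ball_sub_le ha0 hδ hd0 hd1 hd2 hC hcrit hform hΛ
    (by nlinarith) hD1 hD hMhat₁ hM₁.le hlow (Mup := Mtilde₁)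
    (fun x hx => (le_abs_self _).trans (hprior_upper x (hball x hx)))
    (fun x hx => hprior_diff x (hball x hx)) hgrad hSm
  have hRpos : 0 < lm - δ * M₂ := by linarith
  rw [hsum, show n * lm - n * M₂ * δ = n * (lm - δ * M₂) by ring,
    Laplace.ball_bound_eq hn0 hRpos h1D] at hmid
  have hpost := abs_setIntegral_div_sub_le (S := S) hqs
    (fun h => mul_nonneg (Real.exp_pos _).le (hprior_nonneg _)) hBm htail.1
  have hZ := integral_exp_neg_diagForm_pos (b := b) ha0
  have hgauss := abs_setIntegral_div_sub_le (S := S) (integrable_exp_neg_diagForm (b := b) ha0)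
    (fun h => (Real.exp_pos _).le) hBm
    ((mul_pos h1D hZ).trans_le (setIntegral_closedBall_ge ha0 hD))
  have hgaussD : (∫ h in (Metric.closedBall 0 δ)ᶜ, Real.exp (-(1 / 2) * diagForm b a h))
      / (∫ h, Real.exp (-(1 / 2) * diagForm b a h)) ≤ D := by
    rw [div_le_iff₀ hZ]
    have e : (Metric.closedBall (0 : EuclideanSpace ℝ (Fin d)) δ)ᶜ = {h | δ < ‖h‖} := by
      ext x
      simp
    rw [e]
    exact hD
  have htail2 := htail.2
  rw [hZP] at htail2
  set tail := 2 * (n : ℝ) ^ ((d : ℝ) / 2) * Real.exp (-(n * κ)) * Mhat₁ * √|JP.det|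
    / ((2 * Real.pi) ^ ((d : ℝ) / 2) * (1 - DP)) with htaildef
  have htail0 : 0 ≤ tail := by positivity
  have htaileq : Real.exp (-(n * κ)) * Mhat₁ / ((1 - DP) * ((2 * Real.pi) ^ ((d : ℝ) / 2)
      / ((n : ℝ) ^ ((d : ℝ) / 2) * √|JP.det|))) = tail / 2 := by
    rw [htaildef]
    have h1 : (n : ℝ) ^ ((d : ℝ) / 2) ≠ 0 := by positivity
    have h2 : (2 * Real.pi) ^ ((d : ℝ) / 2) ≠ 0 := by positivity
    field_simp
  rw [htaileq] at htail2
  -- The triangle inequality through the two conditioned laws gives the ball term plus D plus tail /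
  -- 2; nonnegativity of D and `tail` relaxes this to the stated 2 * D + tail.
  rw [abs_le] at hmid hpost hgauss ⊢
  constructor <;> linarith [hmid.1, hmid.2, hpost.1, hpost.2, hgauss.1, hgauss.2]
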